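/- Let $n\ge 2$, $s_0>0$ and $\lambda,\Lambda>0$. There is a constant $C$, depending only on $n,\lambda,\Lambda,s_0$, such that the following holds for every $s\in(s_0,1)$, every $W\in C^3(\mathbb{R})$, every $R>0$, and every kernel $K$ in the class $\mathcal L_2(s,\lambda,\Lambda)$, that is, every $K$ of class $C^2$ on $\mathbb{R}^n\setminus\{0\}$ with $$K(z)=K(-z),\qquad \frac{(2-s)\lambda}{|z|^{n+s}}\le K(z)\le \frac{(2-s)\Lambda}{|z|^{n+s}},\qquad \max\bigl\{|z|\,|\partial_eK(z)|,\ |z|^2\,|\partial_{ee}K(z)|\bigr\}\le \frac{(2-s)\Lambda}{|z|^{n+s}}$$ for all $z\in\mathbb{R}^n\setminus\{0\}$ and all unit vectors $e$. Let $B_r$ denote the open ball of radius $r$ centered at the origin, and let $u:\mathbb{R}^n\to(-1,1)$ be a stable solution of $L_Ku+W'(u)=0$ in $B_{2R}$, where $L_Ku(x)=\int_{\mathbb{R}^n}(u(x)-u(\bar x))K(x-\bar x)\,d\bar x$. This means that $u$ is measurable on $\mathbb{R}^n$, is of class $C^2$ in $B_{2R}$, satisfies $L_Ku(x)+W'(u(x))=0$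 for every $x\in B_{2R}$, and $$\frac12\iint_{\mathbb{R}^n\times\mathbb{R}^n}|\xi(x)-\xi(\bar x)|^2K(x-\bar x)\,dx\,d\bar x+\int_{\mathbb{R}^n}W''(u)\,\xi^2\,dx\ \ge\ 0$$ for every Lipschitz function $\xi:\mathbb{R}^n\to\mathbb{R}$ with compact support such that $\xi=0$ outside $B_{2R}$. Then $$\int_{B_R}|\nabla u|\,dx\le \frac{C}{1-s}\,R^{n-1}.$$ In particular $C$ does not depend on $W$. -/

import Mathlib

open MeasureTheory

noncomputable section

/-- The Euclidean space `ℝⁿ`. -/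
abbrev Rn (n : ℕ) : Type := EuclideanSpace ℝ (Fin n)

/-- The ellipticity class `𝓛₂(s, lam, Lam)` of kernels on `ℝⁿ`. The value `K 0` is irrelevant. -/
structure KernelClassL2 (n : ℕ) (s lam Lam : ℝ) (K : Rn n → ℝ) : Prop where
  even : ∀ z : Rn n, K z = K (-z)
  lower : ∀ z : Rn n, z ≠ 0 → (2 - s) * lam / ‖z‖ ^ ((n : ℝ) + s) ≤ K z
  upper : ∀ z : Rn n, z ≠ 0 → K z ≤ (2 - s) * Lam / ‖z‖ ^ ((n : ℝ) + s)
  contDiff : ContDiffOn ℝ 2 K {0}ᶜ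
  deriv_le : ∀ z : Rn n, z ≠ 0 → ∀ e : Rn n, ‖e‖ = 1 →
    ‖z‖ * |fderiv ℝ K z e| ≤ (2 - s) * Lam / ‖z‖ ^ ((n : ℝ) + s)
  deriv2_le : ∀ z : Rn n, z ≠ 0 → ∀ e : Rn n, ‖e‖ = 1 →
    ‖z‖ ^ 2 * |fderiv ℝ (fun y => fderiv ℝ K y e) z e|
      ≤ (2 - s) * Lam / ‖z‖ ^ ((n : ℝ) + s)

/-- The operator `L_K u (x) = ∫ (u x - u y) K (x - y) dy`. When `K` is in `𝓛₂` with
`0 < s < 1`, the integral converges absolutely for every bounded measurable `u` that is `C¹`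
near `x`, so that no principal value is needed. -/
def opL {n : ℕ} (K : Rn n → ℝ) (u : Rn n → ℝ) (x : Rn n) : ℝ :=
  ∫ y : Rn n, (u x - u y) * K (x - y)

/-- `u` is a solution of `L_K u + W'(u) = 0` in `Ω` (for kernels of order `s < 1`): a bounded
measurable function on all of `ℝⁿ` which is a `C²` strong solution in `Ω`. -/
structure IsSolution {n : ℕ} (K : Rn n → ℝ) (W : ℝ → ℝ) (Ω : Set (Rn n))
    (u : Rn n → ℝ) : Prop where
  aemeasurable : AEMeasurable u volume
  bounded : ∃ M : ℝ, ∀ x, |u x| ≤ M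
  contDiffOn : ContDiffOn ℝ 2 u Ω
  equation : ∀ x ∈ Ω, opL K u x + deriv W (u x) = 0

/-- `u` is a stable solution of `L_K u + W'(u) = 0` in `Ω`: a solution at which the second
variation of the energy is nonnegative on all compactly supported Lipschitz functions which
vanish outside `Ω`. -/
structure IsStableSolution {n : ℕ} (K : Rn n → ℝ) (W : ℝ → ℝ) (Ω : Set (Rn n))
    (u : Rn n → ℝ) : Prop extends IsSolution K W Ω u where
  stable : ∀ ξ : Rn n → ℝ, (∃ k : NNReal, LipschitzWith k ξ) → HasCompactSupport ξ →
    (∀ x, x ∉ Ω → ξ x = 0) →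
    0 ≤ (1 / 2 : ℝ) * (∫ p : Rn n × Rn n, (ξ p.1 - ξ p.2) ^ 2 * K (p.1 - p.2))
      + ∫ x : Rn n, iteratedDeriv 2 W (u x) * ξ x ^ 2

end

/-! Let `v = η ∂ₑu` with `η` a cutoff, and let `Q` be the second variation of the energy. Formally
`∂ₑu` solves the linearised equation, so `Q(v) = ½∬ ∂ₑu(x) ∂ₑu(y) (η(x) - η(y))² K(x - y)`. Moving
both derivatives off `u` turns this into `½∬ (u(x) - u(y))² cutoffKernel`. The bounds defining the
class give `|cutoffKernel| ≤ C A² |x - y|^{-n-s}`, where `A` bounds `∇η`, so `Q(v)` is at most `C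
A²` times the Sobolev energy of `u`.

Stability is used at `|v|` rather than at `v`: `Q(|v|) ≥ 0`, while `Q(v) - Q(|v|) = ∬ (|v(x)||v(y)|
- v(x)v(y)) K(x - y)`. The potential term is the same for both, and the differentiated equation
eliminates it, so `W` leaves no trace. Since `K` is bounded below on the bounded set `supp η × supp
η`, the double integral dominates a multiple of `(∫|v|)² - (∫v)²` (`stability_inequality`); and `∫v
= -∫u ∂ₑη` is controlled because `u` is bounded.

The energy is linear in `∇u`: `|u| ≤ 1` gives `(u(x) - u(y))² ≤ 2|u(x) - u(y)|`, and integrating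
`∇u` along segments bounds the near part by `C R^{1-s}/(1-s) ∫|∇u|` on a larger ball
(`sobolevEnergy_le`). Thus the square of `∫|∂ₑu|` is bounded by a first power of `∫|∇u|`. The
arithmetic-geometric mean inequality and a sum over directions give `I(ρ) ≤ ½ I(ρ + 3d) + error` for
`I(r) = ∫_{B_r} |∇u|`, and `le_of_iterated_bound` absorbs the first term.

Two obstacles shape the details. `K` is singular, so the integrations by parts are done for
`χ(tz)K(z)`, with bounds uniform in `t`, and `t → ∞` afterwards. And `u` is only bounded and
measurable outside the domain, so derivatives may fall only on the kernel and on products with a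
cutoff. -/

/-- The derivative of `f` in the direction `e`. -/
noncomputable abbrev dirDeriv {n : ℕ} (e : Rn n) (f : Rn n → ℝ) : Rn n → ℝ := fun x => fderiv ℝ f x e

theorem dirDeriv_comp_neg {n : ℕ} (e : Rn n) (f : Rn n → ℝ) (z : Rn n) :
    dirDeriv e (fun z => f (-z)) z = - dirDeriv e f (-z) := by
  have h := fderiv_comp_smul (𝕜 := ℝ) (f := f) (x := z) (c := -1)
  simp only [neg_smul, one_smul] at h
  simp only [dirDeriv, h, neg_apply]

/-! ### Bookkeeping for integrals and bounded factors. -/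

/-- `f` is integrable with integral `c`. -/
def IntegrableWith {α : Type*} [MeasurableSpace α] (μ : Measure α) (f : α → ℝ) (c : ℝ) : Prop :=
  Integrable f μ ∧ ∫ x, f x ∂μ = c

namespace IntegrableWith

variable {α : Type*} [MeasurableSpace α] {μ : Measure α} {f g : α → ℝ} {a b : ℝ}

theorem of_integrable (hf : Integrable f μ) : IntegrableWith μ f (∫ x, f x ∂μ) :=
  ⟨hf, rfl⟩

theorem add (hf : IntegrableWith μ f a) (hg : IntegrableWith μ g b) :
    IntegrableWith μ (fun x => f x + g x) (a + b) :=
  ⟨hf.1.add hg.1, by rw [integral_add hf.1 hg.1, hf.2, hg.2]⟩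

theorem sub (hf : IntegrableWith μ f a) (hg : IntegrableWith μ g b) :
    IntegrableWith μ (fun x => f x - g x) (a - b) :=
  ⟨hf.1.sub hg.1, by rw [integral_sub hf.1 hg.1, hf.2, hg.2]⟩

theorem smul (c : ℝ) (hf : IntegrableWith μ f a) :
    IntegrableWith μ (fun x => c * f x) (c * a) :=
  ⟨hf.1.const_mul c, by rw [integral_const_mul, hf.2]⟩

theorem congr (hf : IntegrableWith μ f a) (h : ∀ x, g x = f x) (hab : b = a) :
    IntegrableWith μ g b := by
  obtain rfl : g = f := funext h
  exact hab ▸ hf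

end IntegrableWith

/-- A bounded almost everywhere measurable function. -/
structure BddMeas {n : ℕ} (b : Rn n → ℝ) : Prop where
  meas : AEStronglyMeasurable b volume
  bdd : ∃ C, ∀ x, |b x| ≤ C

namespace BddMeas

variable {n : ℕ} {a b : Rn n → ℝ}

theorem const (c : ℝ) : BddMeas (fun _ : Rn n => c) :=
  ⟨aestronglyMeasurable_const, |c|, fun _ => le_rfl⟩

theorem mul (ha : BddMeas a) (hb : BddMeas b) : BddMeas (fun x => a x * b x) := by
  obtain ⟨C, hC⟩ := ha.bdd
  obtain ⟨D, hD⟩ := hb.bdd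
  refine ⟨ha.meas.mul hb.meas, C * D, fun x => ?_⟩
  rw [abs_mul]
  exact mul_le_mul (hC x) (hD x) (abs_nonneg _) ((abs_nonneg _).trans (hC x))

theorem of_continuous (hb : Continuous b) (hc : HasCompactSupport b) : BddMeas b := by
  obtain ⟨C, hC⟩ := hc.exists_bound_of_continuous hb
  exact ⟨hb.aestronglyMeasurable, C, hC⟩

theorem integrable_mul (hb : BddMeas b) (ha : Integrable a) :
    Integrable (fun x => a x * b x) := by
  obtain ⟨C, hC⟩ := hb.bdd
  exact ha.mul_bdd (c := C) hb.meas (Filter.Eventually.of_forall hC)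

end BddMeas

/-! ### Bilinear forms of an integrable kernel and integration by parts. -/

/-- The bilinear form `∬ a(x) b(y) k(x - y) dx dy`. -/
noncomputable def kernelForm {n : ℕ} (k a b : Rn n → ℝ) : ℝ :=
  ∫ p : Rn n × Rn n, a p.1 * b p.2 * k (p.1 - p.2)

section KernelForm

variable {n : ℕ} {k a b : Rn n → ℝ}

/-- One integrable and one bounded factor suffice; this asymmetry matters because `u` is merely
bounded on the whole space. -/
theorem integrable_kernelForm_right (hk : Integrable k) (ha : BddMeas a) (hb : Integrable b) :
    Integrable (fun p : Rn n × Rn n => a p.1 * b p.2 * k (p.1 - p.2)) := by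
  have h : Integrable (fun p : Rn n × Rn n => b p.2 * k (p.1 - p.2)) :=
    Integrable.convolution_integrand (ContinuousLinearMap.mul ℝ ℝ) hb hk
  obtain ⟨C, hC⟩ := ha.bdd
  have := h.bdd_mul (f := fun p : Rn n × Rn n => a p.1) (c := C) ha.meas.comp_fst
    (Filter.Eventually.of_forall fun p => hC p.1)
  simpa only [mul_assoc] using this

theorem integrable_kernelForm_left (hk : Integrable k) (ha : Integrable a) (hb : BddMeas b) :
    Integrable (fun p : Rn n × Rn n => a p.1 * b p.2 * k (p.1 - p.2)) := by
  have h := (integrable_kernelForm_right hk.comp_neg hb ha).swap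
  refine h.congr (Filter.Eventually.of_forall fun p => ?_)
  simp only [Function.comp, Prod.fst_swap, Prod.snd_swap, neg_sub]
  ring

theorem kernelForm_swap (k a b : Rn n → ℝ) :
    kernelForm k a b = kernelForm (fun z => k (-z)) b a := by
  unfold kernelForm
  rw [Measure.volume_eq_prod, ← integral_prod_swap]
  refine integral_congr_ae (Filter.Eventually.of_forall fun p => ?_)
  simp only [Prod.fst_swap, Prod.snd_swap, neg_sub]
  ring

theorem kernelForm_const_right (hk : Integrable k) (ha : Integrable a) :
    kernelForm k a (fun _ => 1) = (∫ x, a x) * ∫ z, k z := by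
  unfold kernelForm
  rw [Measure.volume_eq_prod,
    integral_prod _ (integrable_kernelForm_left hk ha (BddMeas.const 1)), ← integral_mul_const]
  refine integral_congr_ae (Filter.Eventually.of_forall fun x => ?_)
  simp only [mul_one]
  rw [integral_const_mul, integral_sub_left_eq_self (fun z => k z) volume x]

/-- Integration by parts in `x` for each fixed `y`, so nothing is differentiated in `b`. -/
theorem kernelForm_dirDeriv_left {e : Rn n} {p : Rn n → ℝ} (hk : Differentiable ℝ k)
    (hk0 : Integrable k) (hk1 : Integrable (dirDeriv e k)) (hp : ContDiff ℝ 1 p)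
    (hpc : HasCompactSupport p) (hb : BddMeas b) :
    kernelForm k (dirDeriv e p) b = - kernelForm (dirDeriv e k) p b := by
  have hpi : Integrable p := hp.continuous.integrable_of_hasCompactSupport hpc
  have hdc : Continuous (dirDeriv e p) := (hp.continuous_fderiv one_ne_zero).clm_apply
    continuous_const
  have hds : HasCompactSupport (dirDeriv e p) := hpc.fderiv_apply ℝ e
  have hdi : Integrable (dirDeriv e p) := hdc.integrable_of_hasCompactSupport hds
  unfold kernelForm
  rw [Measure.volume_eq_prod, integral_prod_symm _ (integrable_kernelForm_left hk0 hdi hb),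
    integral_prod_symm _ (integrable_kernelForm_left hk1 hpi hb), ← integral_neg]
  refine integral_congr_ae (Filter.Eventually.of_forall fun y => ?_)
  have hder : ∀ x, dirDeriv e (fun x => k (x - y)) x = dirDeriv e k (x - y) := fun x => by
    simp only [dirDeriv, fderiv_comp_sub]
  have hb1 : BddMeas p := BddMeas.of_continuous hp.continuous hpc
  have hb2 : BddMeas (dirDeriv e p) := BddMeas.of_continuous hdc hds
  have key := integral_mul_fderiv_eq_neg_fderiv_mul_of_integrable (μ := volume) (v := e)
    (f := fun x => k (x - y)) (g := p)
    (by
      have := hb1.integrable_mul (hk1.comp_sub_right y)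
      exact this.congr (Filter.Eventually.of_forall fun x => by simp only [← hder]))
    (hb2.integrable_mul (hk0.comp_sub_right y)) (hb1.integrable_mul (hk0.comp_sub_right y))
    (fun x _ => (hk _).comp x (by fun_prop)) (fun x _ => hp.differentiable one_ne_zero x)
  have e1 : ∀ x, dirDeriv e p x * b y * k (x - y) = b y * (k (x - y) * fderiv ℝ p x e) :=
    fun x => by simp only [dirDeriv]; ring
  have e2 : ∀ x, p x * b y * dirDeriv e k (x - y)
      = b y * (fderiv ℝ (fun x => k (x - y)) x e * p x) := fun x => by
    rw [← hder]; simp only [dirDeriv]; ring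
  simp only [e1, e2, integral_const_mul, key]
  ring

theorem integral_dirDeriv_eq_zero {e : Rn n} (hk : Differentiable ℝ k)
    (hk0 : Integrable k) (hk1 : Integrable (dirDeriv e k)) : ∫ x, dirDeriv e k x = 0 := by
  have := integral_mul_fderiv_eq_neg_fderiv_mul_of_integrable (μ := volume) (v := e)
    (f := fun _ : Rn n => (1 : ℝ)) (g := k) (by simp) (by simpa using hk1) (by simpa using hk0)
    (fun x _ => by fun_prop) (fun x _ => hk x)
  simpa using this

end KernelForm

/-! ### Even regular kernels. -/

/-- An even `C²` kernel, integrable together with its first two derivatives in direction `e`. -/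
structure SmoothKernel {n : ℕ} (e : Rn n) (k : Rn n → ℝ) : Prop where
  contDiff : ContDiff ℝ 2 k
  even : ∀ z, k (-z) = k z
  int0 : Integrable k
  int1 : Integrable (dirDeriv e k)
  int2 : Integrable (dirDeriv e (dirDeriv e k))

namespace SmoothKernel

variable {n : ℕ} {e : Rn n} {k : Rn n → ℝ}

theorem contDiff_dirDeriv (hk : SmoothKernel e k) : ContDiff ℝ 1 (dirDeriv e k) :=
  (hk.contDiff.fderiv_right (m := 1) (by norm_num)).clm_apply contDiff_const

theorem odd (hk : SmoothKernel e k) (z : Rn n) : dirDeriv e k (-z) = - dirDeriv e k z := by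
  have h := dirDeriv_comp_neg e k z
  rw [show (fun z => k (-z)) = k from funext hk.even] at h
  rw [h, neg_neg]

theorem even2 (hk : SmoothKernel e k) (z : Rn n) :
    dirDeriv e (dirDeriv e k) (-z) = dirDeriv e (dirDeriv e k) z := by
  have h := dirDeriv_comp_neg e (dirDeriv e k) z
  rw [show (fun z => dirDeriv e k (-z)) = fun z => - dirDeriv e k z from funext hk.odd] at h
  simp only [dirDeriv, fderiv_fun_neg, neg_apply, neg_inj] at h
  exact h.symm

theorem form0_symm (hk : SmoothKernel e k) (a b : Rn n → ℝ) :
    kernelForm k a b = kernelForm k b a := by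
  rw [kernelForm_swap]; congr 1; exact funext hk.even

theorem form1_symm (hk : SmoothKernel e k) (a b : Rn n → ℝ) :
    kernelForm (dirDeriv e k) a b = - kernelForm (dirDeriv e k) b a := by
  rw [kernelForm_swap]
  unfold kernelForm
  simp only [hk.odd, mul_neg, integral_neg]

theorem form2_symm (hk : SmoothKernel e k) (a b : Rn n → ℝ) :
    kernelForm (dirDeriv e (dirDeriv e k)) a b = kernelForm (dirDeriv e (dirDeriv e k)) b a := by
  rw [kernelForm_swap]; congr 1; exact funext hk.even2

theorem form0_dirDeriv (hk : SmoothKernel e k) {p b : Rn n → ℝ} (hp : ContDiff ℝ 1 p)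
    (hpc : HasCompactSupport p) (hb : BddMeas b) :
    kernelForm k (dirDeriv e p) b = - kernelForm (dirDeriv e k) p b :=
  kernelForm_dirDeriv_left (hk.contDiff.differentiable two_ne_zero) hk.int0 hk.int1 hp hpc hb

theorem form1_dirDeriv (hk : SmoothKernel e k) {p b : Rn n → ℝ} (hp : ContDiff ℝ 1 p)
    (hpc : HasCompactSupport p) (hb : BddMeas b) :
    kernelForm (dirDeriv e k) (dirDeriv e p) b = - kernelForm (dirDeriv e (dirDeriv e k)) p b :=
  kernelForm_dirDeriv_left (hk.contDiff_dirDeriv.differentiable one_ne_zero)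
    hk.int1 hk.int2 hp hpc hb

theorem form1_const (hk : SmoothKernel e k) {a : Rn n → ℝ} (ha : Integrable a) :
    kernelForm (dirDeriv e k) a (fun _ => 1) = 0 := by
  rw [kernelForm_const_right hk.int1 ha, integral_dirDeriv_eq_zero
    (hk.contDiff.differentiable two_ne_zero) hk.int0 hk.int1, mul_zero]

theorem form2_const (hk : SmoothKernel e k) {a : Rn n → ℝ} (ha : Integrable a) :
    kernelForm (dirDeriv e (dirDeriv e k)) a (fun _ => 1) = 0 := by
  rw [kernelForm_const_right hk.int2 ha, integral_dirDeriv_eq_zero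
    (hk.contDiff_dirDeriv.differentiable one_ne_zero) hk.int1 hk.int2, mul_zero]

end SmoothKernel

/-! ### Products with a cutoff supported in the domain. -/

section Localization

variable {n : ℕ} {Ω : Set (Rn n)} {η f : Rn n → ℝ}

theorem ContDiff.mul_of_tsupport_subset {m : WithTop ℕ∞} (hη : ContDiff ℝ m η)
    (hΩ : IsOpen Ω) (hf : ContDiffOn ℝ m f Ω) (hs : tsupport η ⊆ Ω) :
    ContDiff ℝ m (fun x => η x * f x) := by
  rw [contDiff_iff_contDiffAt]
  intro x
  by_cases hx : x ∈ Ω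
  · exact hη.contDiffAt.mul (hf.contDiffAt (hΩ.mem_nhds hx))
  · have h0 : η =ᶠ[nhds x] 0 := notMem_tsupport_iff_eventuallyEq.1 fun h => hx (hs h)
    have : (fun x => η x * f x) =ᶠ[nhds x] fun _ => 0 := by
      filter_upwards [h0] with y hy
      simp [hy]
    exact contDiffAt_const.congr_of_eventuallyEq this

/-- The product rule holds at every point: off `Ω` both `η` and its derivative vanish, whatever
value `fderiv` assigns to `f` there. -/
theorem dirDeriv_mul_of_tsupport_subset (e : Rn n) (hη : Differentiable ℝ η)
    (hΩ : IsOpen Ω) (hf : DifferentiableOn ℝ f Ω) (hs : tsupport η ⊆ Ω) (x : Rn n) :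
    dirDeriv e (fun x => η x * f x) x = η x * dirDeriv e f x + dirDeriv e η x * f x := by
  by_cases hx : x ∈ Ω
  · simp only [dirDeriv]
    rw [fderiv_fun_mul (hη x) (hf.differentiableAt (hΩ.mem_nhds hx))]
    simp [mul_comm]
  · have h0 : η =ᶠ[nhds x] 0 := notMem_tsupport_iff_eventuallyEq.1 fun h => hx (hs h)
    have h1 : (fun x => η x * f x) =ᶠ[nhds x] fun _ => 0 := by
      filter_upwards [h0] with y hy
      simp [hy]
    have h2 : fderiv ℝ η x = 0 := by
      rw [h0.fderiv_eq]; simp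
    simp only [dirDeriv]
    rw [h1.fderiv_eq, h2, h0.eq_of_nhds]
    simp

theorem ContDiff.continuous_dirDeriv {f : Rn n → ℝ} (hf : ContDiff ℝ 1 f) (e : Rn n) :
    Continuous (dirDeriv e f) :=
  (hf.continuous_fderiv one_ne_zero).clm_apply continuous_const

end Localization

/-! ### Additivity of the forms. -/

section FormAlgebra

variable {n : ℕ} {k a b a' b' : Rn n → ℝ}

theorem integrableWith_kernelForm_left (hk : Integrable k) (ha : Integrable a) (hb : BddMeas b) :
    IntegrableWith volume (fun p : Rn n × Rn n => a p.1 * b p.2 * k (p.1 - p.2))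
      (kernelForm k a b) :=
  ⟨integrable_kernelForm_left hk ha hb, rfl⟩

theorem integrableWith_kernelForm_right (hk : Integrable k) (ha : BddMeas a) (hb : Integrable b) :
    IntegrableWith volume (fun p : Rn n × Rn n => a p.1 * b p.2 * k (p.1 - p.2))
      (kernelForm k a b) :=
  ⟨integrable_kernelForm_right hk ha hb, rfl⟩

theorem kernelForm_add_left (hk : Integrable k) (ha : Integrable a) (ha' : Integrable a')
    (hb : BddMeas b) :
    kernelForm k (fun x => a x + a' x) b = kernelForm k a b + kernelForm k a' b :=
  (((integrableWith_kernelForm_left hk ha hb).add (integrableWith_kernelForm_left hk ha' hb)).congr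
    (g := fun p : Rn n × Rn n => (a p.1 + a' p.1) * b p.2 * k (p.1 - p.2))
    (fun p => by ring) rfl).2

theorem kernelForm_add_right (hk : Integrable k) (ha : Integrable a) (hb : BddMeas b)
    (hb' : BddMeas b') :
    kernelForm k a (fun x => b x + b' x) = kernelForm k a b + kernelForm k a b' :=
  (((integrableWith_kernelForm_left hk ha hb).add (integrableWith_kernelForm_left hk ha hb')).congr
    (g := fun p : Rn n × Rn n => a p.1 * (b p.2 + b' p.2) * k (p.1 - p.2))
    (fun p => by ring) rfl).2

end FormAlgebra

/-! ### The cutoff kernel and the second variation for a regular kernel. -/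

/-- The kernel `-½ ∂ₓ∂ᵧ [(η(x) - η(y))² k(x - y)]`, derivatives being taken in direction `e`. -/
noncomputable def cutoffKernel {n : ℕ} (e : Rn n) (k η : Rn n → ℝ) (p : Rn n × Rn n) : ℝ :=
  1 / 2 * (η p.1 - η p.2) ^ 2 * dirDeriv e (dirDeriv e k) (p.1 - p.2)
    + (η p.1 - η p.2) * (dirDeriv e η p.1 + dirDeriv e η p.2) * dirDeriv e k (p.1 - p.2)
    + dirDeriv e η p.1 * dirDeriv e η p.2 * k (p.1 - p.2)

section CutoffKernel

variable {n : ℕ} {e : Rn n} {k η f g u : Rn n → ℝ}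

theorem integrableWith_cutoffKernel (hk : SmoothKernel e k) (hη : ContDiff ℝ 1 η)
    (hc : HasCompactSupport η) (hf : BddMeas f) (hg : BddMeas g) :
    IntegrableWith volume (fun p : Rn n × Rn n => f p.1 * g p.2 * cutoffKernel e k η p)
      (1 / 2 * kernelForm (dirDeriv e (dirDeriv e k)) (fun x => η x * η x * f x) g
        - kernelForm (dirDeriv e (dirDeriv e k)) (fun x => η x * f x) (fun x => η x * g x)
        + 1 / 2 * kernelForm (dirDeriv e (dirDeriv e k)) f (fun x => η x * η x * g x)
        + kernelForm (dirDeriv e k) (fun x => η x * dirDeriv e η x * f x) g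
        + kernelForm (dirDeriv e k) (fun x => η x * f x) (fun x => dirDeriv e η x * g x)
        - kernelForm (dirDeriv e k) (fun x => dirDeriv e η x * f x) (fun x => η x * g x)
        - kernelForm (dirDeriv e k) f (fun x => η x * dirDeriv e η x * g x)
        + kernelForm k (fun x => dirDeriv e η x * f x) (fun x => dirDeriv e η x * g x)) := by
  have c0 := hη.continuous
  have c1 := hη.continuous_dirDeriv e
  have s1 : HasCompactSupport (dirDeriv e η) := hc.fderiv_apply ℝ e
  have b0 := BddMeas.of_continuous c0 hc
  have b1 := BddMeas.of_continuous c1 s1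
  have i0 : Integrable η := c0.integrable_of_hasCompactSupport hc
  have i1 : Integrable (dirDeriv e η) := c1.integrable_of_hasCompactSupport s1
  have i00 := b0.integrable_mul i0
  have i01 := b1.integrable_mul i0
  have m1 := integrableWith_kernelForm_left hk.int2 (hf.integrable_mul i00) hg
  have m2 := integrableWith_kernelForm_left hk.int2 (hf.integrable_mul i0) (b0.mul hg)
  have m3 := integrableWith_kernelForm_right hk.int2 hf (hg.integrable_mul i00)
  have m4 := integrableWith_kernelForm_left hk.int1 (hf.integrable_mul i01) hg
  have m5 := integrableWith_kernelForm_left hk.int1 (hf.integrable_mul i0) (b1.mul hg)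
  have m6 := integrableWith_kernelForm_left hk.int1 (hf.integrable_mul i1) (b0.mul hg)
  have m7 := integrableWith_kernelForm_right hk.int1 hf (hg.integrable_mul i01)
  have m8 := integrableWith_kernelForm_left hk.int0 (hf.integrable_mul i1) (b1.mul hg)
  refine ((((((((m1.smul (1 / 2)).sub m2).add (m3.smul (1 / 2))).add m4).add m5).sub m6).sub
    m7).add m8).congr (fun p => ?_) rfl
  simp only [cutoffKernel]
  ring

/-- `cutoffKernel` is a derivative in the second variable, so it integrates to zero against a
function of the first. As `f` need not be differentiable, this is obtained as a linear relation
among forms, each integration by parts acting on a factor of `η`. -/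
theorem integral_fst_mul_cutoffKernel (hk : SmoothKernel e k) (hη : ContDiff ℝ 1 η)
    (hc : HasCompactSupport η) (hf : BddMeas f) :
    IntegrableWith volume (fun p : Rn n × Rn n => f p.1 * cutoffKernel e k η p) 0 := by
  have c0 := hη.continuous
  have c1 := hη.continuous_dirDeriv e
  have s1 : HasCompactSupport (dirDeriv e η) := hc.fderiv_apply ℝ e
  have b0 := BddMeas.of_continuous c0 hc
  have b1 := BddMeas.of_continuous c1 s1
  have i0 : Integrable η := c0.integrable_of_hasCompactSupport hc
  have i1 : Integrable (dirDeriv e η) := c1.integrable_of_hasCompactSupport s1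
  have i00 := b0.integrable_mul i0
  have i01 := b1.integrable_mul i0
  refine (integrableWith_cutoffKernel hk hη hc hf (BddMeas.const 1)).congr (fun p => by ring) ?_
  simp only [mul_one]
  have z1 := hk.form2_const (hf.integrable_mul i00)
  have z2 := hk.form1_const (hf.integrable_mul i01)
  have z3 := hk.form1_dirDeriv hη hc (b0.mul hf)
  have z4 := hk.form0_dirDeriv hη hc (b1.mul hf)
  have hηη : ContDiff ℝ 1 (fun x => η x * η x) := hη.mul hη
  have z5 := hk.form1_dirDeriv hηη hc.mul_right hf
  have hd : dirDeriv e (fun x => η x * η x)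
      = fun x => η x * dirDeriv e η x + η x * dirDeriv e η x := by
    funext x
    rw [dirDeriv_mul_of_tsupport_subset e (hη.differentiable one_ne_zero) isOpen_univ
      (hη.differentiable one_ne_zero).differentiableOn (Set.subset_univ _)]
    ring
  rw [hd, kernelForm_add_left hk.int1 i01 i01 hf] at z5
  have w1 := hk.form2_symm f (fun x => η x * η x)
  have w2 := hk.form1_symm f (fun x => η x * dirDeriv e η x)
  have w3 := hk.form1_symm (dirDeriv e η) (fun x => η x * f x)
  have w4 := hk.form2_symm (fun x => η x * f x) η
  have w5 := hk.form1_symm (fun x => dirDeriv e η x * f x) η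
  have w6 := hk.form0_symm (fun x => dirDeriv e η x * f x) (dirDeriv e η)
  linarith

theorem cutoffKernel_swap (hk : SmoothKernel e k) (p : Rn n × Rn n) :
    cutoffKernel e k η p.swap = cutoffKernel e k η p := by
  have h : p.2 - p.1 = -(p.1 - p.2) := by abel
  simp only [cutoffKernel, Prod.fst_swap, Prod.snd_swap]
  rw [h, hk.even, hk.odd, hk.even2]
  ring

theorem integral_snd_mul_cutoffKernel (hk : SmoothKernel e k) (hη : ContDiff ℝ 1 η)
    (hc : HasCompactSupport η) (hf : BddMeas f) :
    IntegrableWith volume (fun p : Rn n × Rn n => f p.2 * cutoffKernel e k η p) 0 := by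
  obtain ⟨h1, h2⟩ := integral_fst_mul_cutoffKernel hk hη hc hf
  have hs : (fun p : Rn n × Rn n => f p.2 * cutoffKernel e k η p)
      = (fun p : Rn n × Rn n => f p.1 * cutoffKernel e k η p) ∘ Prod.swap := by
    funext p
    simp only [Function.comp, cutoffKernel_swap hk, Prod.fst_swap]
  rw [hs]
  refine ⟨h1.swap, ?_⟩
  rw [← h2]
  exact integral_prod_swap (fun p : Rn n × Rn n => f p.1 * cutoffKernel e k η p)

/-- The second variation at `η ∂ₑu`, for a regular kernel, after integrating by parts twice. -/
theorem integral_secondVariation_eq {Ω : Set (Rn n)} (hk : SmoothKernel e k)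
    (hη : ContDiff ℝ 1 η) (hc : HasCompactSupport η) (hΩ : IsOpen Ω) (hs : tsupport η ⊆ Ω)
    (hu : BddMeas u) (huΩ : ContDiffOn ℝ 2 u Ω) {v ψ : Rn n → ℝ}
    (hv : v = fun x => η x * dirDeriv e u x) (hψ : ψ = fun x => η x * v x) :
    ∫ p : Rn n × Rn n, (1 / 2 * (v p.1 - v p.2) ^ 2 + (u p.1 - u p.2) * dirDeriv e ψ p.1)
        * k (p.1 - p.2)
      = 1 / 2 * ∫ p : Rn n × Rn n, (u p.1 - u p.2) ^ 2 * cutoffKernel e k η p := by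
  have c0 := hη.continuous
  have c1 := hη.continuous_dirDeriv e
  have s1 : HasCompactSupport (dirDeriv e η) := hc.fderiv_apply ℝ e
  have b0 := BddMeas.of_continuous c0 hc
  have b1 := BddMeas.of_continuous c1 s1
  have i0 : Integrable η := c0.integrable_of_hasCompactSupport hc
  have i1 : Integrable (dirDeriv e η) := c1.integrable_of_hasCompactSupport s1
  have d0 := hη.differentiable one_ne_zero
  have huD : ContDiffOn ℝ 1 (dirDeriv e u) Ω :=
    (huΩ.fderiv_of_isOpen (m := 1) hΩ (by norm_num)).clm_apply contDiffOn_const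
  have hu1 : ContDiffOn ℝ 1 u Ω := huΩ.of_le (by norm_num)
  have hud : DifferentiableOn ℝ u Ω := huΩ.differentiableOn two_ne_zero
  have hvC : ContDiff ℝ 1 v := hv ▸ hη.mul_of_tsupport_subset hΩ huD hs
  have hvc : HasCompactSupport v := hv ▸ hc.mul_right
  have hψC : ContDiff ℝ 1 ψ := hψ ▸ hη.mul hvC
  have hψc : HasCompactSupport ψ := hψ ▸ hc.mul_right
  have hψs : tsupport ψ ⊆ Ω := by
    rw [hψ]; exact (tsupport_mul_subset_left (f := η) (g := v)).trans hs
  have hpC : ContDiff ℝ 1 (fun x => η x * u x) := hη.mul_of_tsupport_subset hΩ hu1 hs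
  have hpc : HasCompactSupport (fun x => η x * u x) := hc.mul_right
  have hPC : ContDiff ℝ 1 (fun x => η x * (η x * u x)) := hη.mul hpC
  have hPc : HasCompactSupport (fun x => η x * (η x * u x)) := hc.mul_right
  have bv := BddMeas.of_continuous hvC.continuous hvc
  have iv : Integrable v := hvC.continuous.integrable_of_hasCompactSupport hvc
  have ivv := bv.integrable_mul iv
  have iψ : Integrable ψ := hψC.continuous.integrable_of_hasCompactSupport hψc
  have idψ : Integrable (dirDeriv e ψ) :=
    (hψC.continuous_dirDeriv e).integrable_of_hasCompactSupport (hψc.fderiv_apply ℝ e)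
  have idψu := hu.integrable_mul idψ
  have iq : Integrable (fun x => dirDeriv e η x * u x) := hu.integrable_mul i1
  have bq : BddMeas (fun x => dirDeriv e η x * u x) := b1.mul hu
  have bp : BddMeas (fun x => η x * u x) := b0.mul hu
  have hdp : dirDeriv e (fun x => η x * u x) = fun x => v x + dirDeriv e η x * u x := by
    funext x
    rw [dirDeriv_mul_of_tsupport_subset e d0 hΩ hud hs, hv]
  have hdP : dirDeriv e (fun x => η x * (η x * u x))
      = fun x => ψ x + (η x * dirDeriv e η x * u x + η x * dirDeriv e η x * u x) := by
    funext x
    rw [dirDeriv_mul_of_tsupport_subset e d0 isOpen_univ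
      (hpC.differentiable one_ne_zero).differentiableOn (Set.subset_univ _), hdp, hψ]
    ring
  -- the left-hand side
  have hL : IntegrableWith volume (fun p : Rn n × Rn n =>
      (1 / 2 * (v p.1 - v p.2) ^ 2 + (u p.1 - u p.2) * dirDeriv e ψ p.1) * k (p.1 - p.2))
      (1 / 2 * kernelForm k (fun x => v x * v x) (fun _ => 1)
        + 1 / 2 * kernelForm k (fun _ => 1) (fun x => v x * v x) - kernelForm k v v
        + kernelForm k (fun x => dirDeriv e ψ x * u x) (fun _ => 1)
        - kernelForm k (dirDeriv e ψ) u) :=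
    ((((((integrableWith_kernelForm_left hk.int0 ivv (BddMeas.const 1)).smul (1 / 2)).add
      ((integrableWith_kernelForm_right hk.int0 (BddMeas.const 1) ivv).smul (1 / 2))).sub
      (integrableWith_kernelForm_left hk.int0 iv bv)).add
      (integrableWith_kernelForm_left hk.int0 idψu (BddMeas.const 1))).sub
      (integrableWith_kernelForm_left hk.int0 idψ hu)).congr (fun p => by ring) rfl
  have l1 := hk.form0_symm (fun _ => 1) (fun x => v x * v x)
  -- `∂ₑ(ψu) = v² + u ∂ₑψ` has integral zero.
  have l2 : kernelForm k (fun x => dirDeriv e ψ x * u x) (fun _ => 1)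
      = - kernelForm k (fun x => v x * v x) (fun _ => 1) := by
    rw [kernelForm_const_right hk.int0 idψu, kernelForm_const_right hk.int0 ivv, ← neg_mul]
    congr 1
    have hψuC : ContDiff ℝ 1 (fun x => ψ x * u x) := hψC.mul_of_tsupport_subset hΩ hu1 hψs
    have hψuc : HasCompactSupport (fun x => ψ x * u x) := hψc.mul_right
    have hz := integral_dirDeriv_eq_zero (e := e) (hψuC.differentiable one_ne_zero)
      (hψuC.continuous.integrable_of_hasCompactSupport hψuc)
      ((hψuC.continuous_dirDeriv e).integrable_of_hasCompactSupport (hψuc.fderiv_apply ℝ e))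
    have hd : ∀ x, dirDeriv e (fun x => ψ x * u x) x = v x * v x + dirDeriv e ψ x * u x := by
      intro x
      rw [dirDeriv_mul_of_tsupport_subset e (hψC.differentiable one_ne_zero) hΩ hud hψs]
      simp only [hψ, hv]
      ring
    simp only [hd] at hz
    rw [integral_add ivv idψu] at hz
    linarith
  -- Two integrations by parts reduce the form of `∂ₑψ` and `u` to forms without derivatives of `u`:
  -- first `∂ₑ` leaves `ψ`, then `ψ` is itself `∂ₑ(η²u)` up to a term `2η ∂ₑη u`.
  have l3 := hk.form0_dirDeriv hψC hψc hu
  have l4 := hk.form1_dirDeriv hPC hPc hu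
  have ir := hu.integrable_mul (b1.integrable_mul i0)
  have irr : Integrable (fun x => η x * dirDeriv e η x * u x + η x * dirDeriv e η x * u x) :=
    ir.add ir
  rw [hdP, kernelForm_add_left hk.int1 iψ irr hu, kernelForm_add_left hk.int1 ir ir hu]
    at l4
  -- The form of `v` with itself is treated through `v = ∂ₑ(ηu) - u ∂ₑη`, with every `∂ₑ(ηu)` moved
  -- onto the kernel.
  have l5 := hk.form0_dirDeriv hpC hpc bq
  have hbd : BddMeas (dirDeriv e (fun x => η x * u x)) :=
    BddMeas.of_continuous (hpC.continuous_dirDeriv e) (hpc.fderiv_apply ℝ e)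
  have l6 := hk.form0_dirDeriv hpC hpc hbd
  have l7 := hk.form1_dirDeriv hpC hpc bp
  rw [hk.form1_symm (fun x => η x * u x), l7, neg_neg] at l6
  rw [hdp, kernelForm_add_left hk.int0 iv iq bq] at l5
  rw [hdp, kernelForm_add_left hk.int0 iv iq (hdp ▸ hbd), kernelForm_add_right hk.int0 iv bv bq,
    kernelForm_add_right hk.int0 iq bv bq] at l6
  have l8 := hk.form0_symm (fun x => dirDeriv e η x * u x) v
  -- the right-hand side
  have r1 := integral_fst_mul_cutoffKernel hk hη hc (hu.mul hu)
  have r2 := integral_snd_mul_cutoffKernel hk hη hc (hu.mul hu)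
  have r3 := integrableWith_cutoffKernel hk hη hc hu hu
  -- On expanding the square, the terms `u(x)²` and `u(y)²` contribute zero and only the cross term
  -- survives.
  have hR := ((r1.add r2).sub (r3.smul 2)).congr
    (g := fun p : Rn n × Rn n => (u p.1 - u p.2) ^ 2 * cutoffKernel e k η p)
    (fun p => by ring) rfl
  rw [hL.2, hR.2]
  have w1 := hk.form2_symm u (fun x => η x * η x * u x)
  have w2 := hk.form1_symm u (fun x => η x * dirDeriv e η x * u x)
  have w3 := hk.form1_symm (fun x => dirDeriv e η x * u x) (fun x => η x * u x)
  have hP : (fun x => η x * (η x * u x)) = fun x => η x * η x * u x := by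
    funext x; ring
  rw [hP] at l4
  linarith

end CutoffKernel

/-! ### Integrals of powers of the norm. -/

section Radial

variable {n : ℕ}

/-- The area of the unit sphere of `ℝⁿ`. -/
noncomputable def sphereArea (n : ℕ) : ℝ :=
  n * (volume : Measure (Rn n)).real (Metric.ball 0 1)

theorem sphereArea_nonneg (n : ℕ) : 0 ≤ sphereArea n := by
  unfold sphereArea; positivity

/-- Polar coordinates: the Jacobian `y^{n-1}` turns `y^{a+1-n}` into `y^a`. It is used with `a = -s`
near the origin and `a = -1-s` far from it. -/
theorem integrableWith_indicator_norm_rpow (hn : 0 < n) {S : Set ℝ} (hS : MeasurableSet S)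
    (hS0 : S ⊆ Set.Ioi 0) {a : ℝ} (ha : IntegrableOn (fun y : ℝ => y ^ a) S) :
    IntegrableWith volume (fun z : Rn n => S.indicator (fun y : ℝ => y ^ (a + 1 - n)) ‖z‖)
      (sphereArea n * ∫ y in S, y ^ a) := by
  have : Nonempty (Fin n) := ⟨⟨0, hn⟩⟩
  have hfun : ∀ y ∈ Set.Ioi (0 : ℝ), y ^ (Module.finrank ℝ (Rn n) - 1) •
      S.indicator (fun y : ℝ => y ^ (a + 1 - n)) y = S.indicator (fun y : ℝ => y ^ a) y := by
    intro y hy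
    by_cases hyS : y ∈ S
    · rw [Set.indicator_of_mem hyS, Set.indicator_of_mem hyS, finrank_euclideanSpace,
        Fintype.card_fin, smul_eq_mul, ← Real.rpow_natCast, ← Real.rpow_add hy]
      congr 1
      rw [Nat.cast_sub hn]
      push_cast
      ring
    · rw [Set.indicator_of_notMem hyS, Set.indicator_of_notMem hyS, smul_zero]
  constructor
  · rw [integrable_fun_norm_addHaar volume, integrableOn_congr_fun hfun measurableSet_Ioi]
    exact ((integrable_indicator_iff hS).2 ha).integrableOn
  · rw [integral_fun_norm_addHaar volume, setIntegral_congr_fun measurableSet_Ioi hfun,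
      setIntegral_indicator hS, Set.inter_eq_self_of_subset_right hS0, finrank_euclideanSpace,
      Fintype.card_fin, sphereArea]
    simp only [nsmul_eq_mul, smul_eq_mul]
    ring

theorem lintegral_ball_norm_rpow (hn : 2 ≤ n) {s ρ : ℝ} (hs0 : 0 < s) (hs : s < 1) (hρ : 0 < ρ) :
    ∫⁻ z in Metric.ball (0 : Rn n) ρ, ENNReal.ofReal (‖z‖ ^ (1 - (n + s)))
      = ENNReal.ofReal (sphereArea n * (ρ ^ (1 - s) / (1 - s))) := by
  have hn2 : (2 : ℝ) ≤ n := by exact_mod_cast hn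
  have hI := (intervalIntegral.integrableOn_Ioo_rpow_iff (s := -s) hρ).2 (by linarith)
  obtain ⟨h1, h2⟩ := integrableWith_indicator_norm_rpow (n := n) (by omega) measurableSet_Ioo
    (fun y hy => hy.1) hI
  have h3 : ∫ y in Set.Ioo 0 ρ, y ^ (-s) = ρ ^ (1 - s) / (1 - s) := by
    rw [← integral_Ioc_eq_integral_Ioo, ← intervalIntegral.integral_of_le hρ.le,
      integral_rpow (Or.inl (by linarith)), Real.zero_rpow (by linarith)]
    congr 1 <;> ring_nf
  rw [h3] at h2
  rw [← h2, ofReal_integral_eq_lintegral_ofReal h1 (Filter.Eventually.of_forall fun z =>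
    Set.indicator_nonneg (fun y hy => Real.rpow_nonneg hy.1.le _) _),
    ← lintegral_indicator measurableSet_ball]
  refine lintegral_congr fun z => ?_
  have he : (-s + 1 - n : ℝ) = 1 - (n + s) := by ring
  rw [he]
  -- The indicator omits the origin; both sides agree there since `rpow` sends zero to zero for a
  -- nonzero exponent.
  by_cases hz : z = 0
  · subst hz
    simp [hρ, Real.zero_rpow (by linarith : (1 - (n + s) : ℝ) ≠ 0)]
  · have hz' : 0 < ‖z‖ := norm_pos_iff.2 hz
    by_cases hzρ : ‖z‖ < ρ <;> simp [Set.indicator, hzρ, hz]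

theorem integrableWith_norm_rpow_far (hn : 2 ≤ n) {s d : ℝ} (hs0 : 0 < s) (hd : 0 < d) :
    IntegrableWith volume
      (fun z : Rn n => (Set.Ici d).indicator (fun y : ℝ => y ^ (-((n : ℝ) + s))) ‖z‖)
      (sphereArea n * (d ^ (-s) / s)) := by
  have hI : IntegrableOn (fun y : ℝ => y ^ (-1 - s)) (Set.Ici d) :=
    (integrableOn_Ici_iff_integrableOn_Ioi).2
      (integrableOn_Ioi_rpow_of_lt (a := -1 - s) (by linarith) hd)
  have h := integrableWith_indicator_norm_rpow (n := n) (by omega) measurableSet_Ici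
    (fun y hy => hd.trans_le hy) hI
  have h3 : ∫ y in Set.Ici d, y ^ (-1 - s) = d ^ (-s) / s := by
    rw [integral_Ici_eq_integral_Ioi, integral_Ioi_rpow_of_lt (by linarith) hd]
    have : -1 - s + 1 = -s := by ring
    rw [this, neg_div_neg_eq]
  rw [h3, show (-1 - s + 1 - n : ℝ) = -(n + s) by ring] at h
  exact h

theorem lintegral_norm_rpow_far (hn : 2 ≤ n) {s d : ℝ} (hs0 : 0 < s) (hd : 0 < d) :
    ∫⁻ z in {z : Rn n | d ≤ ‖z‖}, ENNReal.ofReal (‖z‖ ^ (-((n : ℝ) + s)))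
      = ENNReal.ofReal (sphereArea n * (d ^ (-s) / s)) := by
  obtain ⟨h1, h2⟩ := integrableWith_norm_rpow_far hn hs0 hd
  rw [← h2, ofReal_integral_eq_lintegral_ofReal h1 (Filter.Eventually.of_forall fun z =>
    Set.indicator_nonneg (fun y hy => Real.rpow_nonneg (hd.le.trans hy) _) _),
    ← lintegral_indicator (measurableSet_le measurable_const measurable_norm)]
  refine lintegral_congr fun z => ?_
  by_cases hz : d ≤ ‖z‖ <;> simp [Set.indicator, hz]

theorem integrable_of_le_norm_rpow (hn : 2 ≤ n) {s d C : ℝ} (hs0 : 0 < s) (hd : 0 < d)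
    {g : Rn n → ℝ} (hg : AEStronglyMeasurable g) (h0 : ∀ z, ‖z‖ < d → g z = 0)
    (hb : ∀ z, d ≤ ‖z‖ → |g z| ≤ C * ‖z‖ ^ (-((n : ℝ) + s))) : Integrable g := by
  refine Integrable.mono' ((integrableWith_norm_rpow_far hn hs0 hd).1.const_mul C) hg
    (Filter.Eventually.of_forall fun z => ?_)
  rcases lt_or_ge ‖z‖ d with h | h
  · rw [h0 z h, Set.indicator_of_notMem (by simpa using h)]; simp
  · rw [Set.indicator_of_mem (by simpa using h)]; exact hb z h

/-- `min(1,|z|) |z|^{-n-s}` is integrable on `ℝⁿ`. -/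
theorem integrable_min_mul_norm_rpow (hn : 2 ≤ n) {s : ℝ} (hs0 : 0 < s) (hs : s < 1) :
    Integrable (fun z : Rn n => min 1 ‖z‖ * ‖z‖ ^ (-((n : ℝ) + s))) := by
  have hn2 : (2 : ℝ) ≤ n := by exact_mod_cast hn
  have hI := (intervalIntegral.integrableOn_Ioo_rpow_iff (s := -s) one_pos).2 (by linarith)
  have h1 := (integrableWith_indicator_norm_rpow (n := n) (by omega) measurableSet_Ioo
    (fun y hy => hy.1) hI).1
  have h2 := (integrableWith_norm_rpow_far hn hs0 one_pos).1
  refine (h1.add h2).congr (Filter.Eventually.of_forall fun z => ?_)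
  have he : (-s + 1 - n : ℝ) = 1 + -(n + s) := by ring
  simp only [Pi.add_apply, he]
  by_cases hz : z = 0
  · subst hz
    simp
  · have hz' : 0 < ‖z‖ := norm_pos_iff.2 hz
    rcases lt_or_ge ‖z‖ 1 with h | h
    · rw [Set.indicator_of_mem (show ‖z‖ ∈ Set.Ioo 0 1 from ⟨hz', h⟩),
        Set.indicator_of_notMem (by simpa using h), min_eq_right h.le, add_zero,
        Real.rpow_add hz', Real.rpow_one]
    · rw [Set.indicator_of_notMem (by simp [h]), Set.indicator_of_mem (by simpa using h),
        min_eq_left h, zero_add, one_mul]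

end Radial

/-! ### A function cutting off a neighbourhood of the origin. -/

section Truncation

variable {n : ℕ}

set_option maxSynthPendingDepth 3 in
theorem exists_bound_norm_mul_fderiv {E : Type*} [NormedAddCommGroup E] [NormedSpace ℝ E]
    {β : E → ℝ} (hb : ContDiff ℝ 2 β)
    (hbc : HasCompactSupport β) : ∃ c, ∀ e : E, ‖e‖ = 1 → ∀ z, ‖z‖ * |fderiv ℝ β z e| ≤ c ∧
      ‖z‖ ^ 2 * |fderiv ℝ (fun y => fderiv ℝ β y e) z e| ≤ c := by
  have hb1 : ContDiff ℝ 1 (fderiv ℝ β) := hb.fderiv_right (m := 1) (by norm_num)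
  have c1 : Continuous (fderiv ℝ β) := hb1.continuous
  have c2 : Continuous (fderiv ℝ (fderiv ℝ β)) := hb1.continuous_fderiv one_ne_zero
  have h0 : ∀ z, z ∉ tsupport β → fderiv ℝ β z = 0 := fun z hz =>
    Function.notMem_support.1 fun h => hz (support_fderiv_subset ℝ h)
  have h1 : ∀ z, z ∉ tsupport β → fderiv ℝ (fderiv ℝ β) z = 0 := fun z hz =>
    Function.notMem_support.1 fun h =>
      hz (tsupport_fderiv_subset ℝ (support_fderiv_subset ℝ h))
  have s1 : HasCompactSupport (fun z => ‖z‖ * ‖fderiv ℝ β z‖) :=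
    HasCompactSupport.intro hbc.isCompact fun z hz => by simp [h0 z hz]
  have s2 : HasCompactSupport (fun z => ‖z‖ ^ 2 * ‖fderiv ℝ (fderiv ℝ β) z‖) :=
    HasCompactSupport.intro hbc.isCompact fun z hz => by simp [h1 z hz]
  obtain ⟨C1, hC1⟩ := s1.exists_bound_of_continuous (continuous_norm.mul c1.norm)
  obtain ⟨C2, hC2⟩ := s2.exists_bound_of_continuous ((continuous_norm.pow 2).mul c2.norm)
  refine ⟨max C1 C2, fun e he z => ⟨?_, ?_⟩⟩
  · calc ‖z‖ * |fderiv ℝ β z e| ≤ ‖z‖ * ‖fderiv ℝ β z‖ := by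
          gcongr
          simpa [he] using (fderiv ℝ β z).le_opNorm e
      _ ≤ C1 := (le_abs_self _).trans (hC1 z)
      _ ≤ _ := le_max_left _ _
  · have e2 : fderiv ℝ (fun y => fderiv ℝ β y e) z e = fderiv ℝ (fderiv ℝ β) z e e := by
      rw [fderiv_clm_apply (hb1.differentiable one_ne_zero z) (differentiableAt_const e)]
      simp
    calc ‖z‖ ^ 2 * |fderiv ℝ (fun y => fderiv ℝ β y e) z e|
        ≤ ‖z‖ ^ 2 * ‖fderiv ℝ (fderiv ℝ β) z‖ := by
          rw [e2]
          gcongr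
          simpa [he] using (fderiv ℝ (fderiv ℝ β) z).le_opNorm₂ e e
      _ ≤ C2 := (le_abs_self _).trans (hC2 z)
      _ ≤ _ := le_max_right _ _

/-- A smooth even function vanishing near the origin and equal to `1` away from it. -/
structure IsTruncation (χ : Rn n → ℝ) (c : ℝ) : Prop where
  one_le : 1 ≤ c
  contDiff : ContDiff ℝ 2 χ
  even : ∀ z, χ (-z) = χ z
  zero_near : ∀ z, ‖z‖ ≤ 1 → χ z = 0
  one_far : ∀ z, 2 ≤ ‖z‖ → χ z = 1
  abs_le_one : ∀ z, |χ z| ≤ 1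
  deriv_le : ∀ e : Rn n, ‖e‖ = 1 → ∀ z, ‖z‖ * |dirDeriv e χ z| ≤ c ∧
    ‖z‖ ^ 2 * |dirDeriv e (dirDeriv e χ) z| ≤ c

theorem exists_isTruncation (n : ℕ) : ∃ (χ : Rn n → ℝ) (c : ℝ), IsTruncation χ c := by
  obtain ⟨b, hin, hout⟩ : ∃ b : ContDiffBump (0 : Rn n), b.rIn = 1 ∧ b.rOut = 2 :=
    ⟨⟨1, 2, one_pos, one_lt_two⟩, rfl, rfl⟩
  obtain ⟨C, hC⟩ := exists_bound_norm_mul_fderiv (b.contDiff (n := 2)) b.hasCompactSupport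
  refine ⟨fun z => 1 - b z, max 1 C, le_max_left _ _, contDiff_const.sub (b.contDiff (n := 2)),
    fun z => by beta_reduce; rw [b.neg], fun z hz => ?_, fun z hz => ?_, fun z => ?_, fun e he z => ?_⟩
  · beta_reduce
    rw [b.one_of_mem_closedBall (by simpa [hin] using hz), sub_self]
  · beta_reduce
    rw [b.zero_of_le_dist (by simpa [hout] using hz), sub_zero]
  · beta_reduce
    rw [abs_of_nonneg (by linarith [b.le_one (x := z)])]
    linarith [b.nonneg (x := z)]
  · have e1 : dirDeriv e (fun z => 1 - b z) = fun z => - dirDeriv e b z := by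
      funext z; simp [dirDeriv, fderiv_const_sub]
    have e2 : dirDeriv e (fun z => - dirDeriv e b z) z = - dirDeriv e (dirDeriv e b) z := by
      simp only [dirDeriv, fderiv_fun_neg, neg_apply]
    rw [e1, e2, abs_neg, abs_neg]
    exact ⟨((hC e he z).1).trans (le_max_right _ _), ((hC e he z).2).trans (le_max_right _ _)⟩

theorem dirDeriv_comp_smul (e : Rn n) (f : Rn n → ℝ) (t : ℝ) (z : Rn n) :
    dirDeriv e (fun z => f (t • z)) z = t * dirDeriv e f (t • z) := by
  have h := fderiv_comp_smul (𝕜 := ℝ) (f := f) (x := z) (c := t)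
  simp only [dirDeriv, h]
  simp

theorem dirDeriv_fun_mul {e : Rn n} {f g : Rn n → ℝ} {z : Rn n} (hf : DifferentiableAt ℝ f z)
    (hg : DifferentiableAt ℝ g z) :
    dirDeriv e (fun z => f z * g z) z = f z * dirDeriv e g z + dirDeriv e f z * g z := by
  simp only [dirDeriv]
  rw [fderiv_fun_mul hf hg]
  simp [mul_comm]

end Truncation

theorem KernelClassL2.abs_le {n : ℕ} {s lam Lam : ℝ} {K : Rn n → ℝ}
    (hK : KernelClassL2 n s lam Lam K) (hlam : 0 < lam) (hs : s < 1) (hs0 : 0 < s)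
    (hLam : 0 < Lam) {z : Rn n} (hz : z ≠ 0) :
    |K z| ≤ 2 * Lam * ‖z‖ ^ (-((n : ℝ) + s)) := by
  have hz' : 0 < ‖z‖ := norm_pos_iff.2 hz
  have h0 : 0 ≤ K z := le_trans (by have := Real.rpow_pos_of_pos hz' (n + s)
                                    have : 0 < 2 - s := by linarith
                                    positivity) (hK.lower z hz)
  rw [abs_of_nonneg h0]
  refine (hK.upper z hz).trans ?_
  rw [Real.rpow_neg hz'.le, div_eq_mul_inv]
  have : 0 < ‖z‖ ^ ((n : ℝ) + s) := Real.rpow_pos_of_pos hz' _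
  gcongr
  linarith

theorem KernelClassL2.measurable {n : ℕ} {s lam Lam : ℝ} {K : Rn n → ℝ}
    (hK : KernelClassL2 n s lam Lam K) : Measurable K :=
  measurable_of_continuousOn_compl_singleton 0 hK.contDiff.continuousOn

/-! ### Difference quotients controlled by the gradient. -/

section DifferenceQuotient

variable {n : ℕ} {u : Rn n → ℝ}

theorem enorm_sub_le_lintegral_fderiv {Ω : Set (Rn n)} (hΩ : IsOpen Ω) (hu : ContDiffOn ℝ 1 u Ω)
    {x z : Rn n} (hseg : ∀ t ∈ Set.Icc (0 : ℝ) 1, x + t • z ∈ Ω) :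
    ‖u (x + z) - u x‖ₑ ≤ ‖z‖ₑ * ∫⁻ t in Set.Icc (0 : ℝ) 1, ‖fderiv ℝ u (x + t • z)‖ₑ := by
  have hder : ∀ t ∈ Set.Icc (0 : ℝ) 1,
      HasDerivAt (fun t : ℝ => u (x + t • z)) (fderiv ℝ u (x + t • z) z) t := by
    intro t ht
    have h1 : HasFDerivAt u (fderiv ℝ u (x + t • z)) (x + t • z) :=
      ((hu.contDiffAt (hΩ.mem_nhds (hseg t ht))).differentiableAt one_ne_zero).hasFDerivAt
    have h2 : HasDerivAt (fun t : ℝ => x + t • z) z t := by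
      simpa using ((hasDerivAt_id t).smul_const z).const_add x
    exact h1.comp_hasDerivAt t h2
  have hcont : ContinuousOn (fun t : ℝ => fderiv ℝ u (x + t • z) z) (Set.Icc 0 1) := by
    have h1 : ContinuousOn (fun t : ℝ => fderiv ℝ u (x + t • z)) (Set.Icc 0 1) :=
      (hu.continuousOn_fderiv_of_isOpen hΩ le_rfl).comp (by fun_prop) hseg
    exact h1.clm_apply continuousOn_const
  have hftc : ∫ t in (0 : ℝ)..1, fderiv ℝ u (x + t • z) z = u (x + z) - u x := by
    rw [intervalIntegral.integral_eq_sub_of_hasDerivAt (f := fun t : ℝ => u (x + t • z))]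
    · simp
    · rw [Set.uIcc_of_le zero_le_one]; exact hder
    · exact ContinuousOn.intervalIntegrable (by rwa [Set.uIcc_of_le zero_le_one])
  rw [← hftc, intervalIntegral.integral_of_le zero_le_one, ← integral_Icc_eq_integral_Ioc]
  refine (enorm_integral_le_lintegral_enorm _).trans ?_
  rw [← lintegral_const_mul' _ _ enorm_ne_top]
  refine lintegral_mono fun t => ?_
  rw [mul_comm]
  exact (fderiv ℝ u (x + t • z)).le_opENorm z

/-- Put `y = x + z` and integrate the gradient along the segment, which stays in the convex ball. By
translation invariance each `z` with `|z| < 2r` contributes at most `|z|^{1-n-s} ∫|∇u|`. The radial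
integral converges because `s < 1`, and it is the source of the factor `1/(1-s)`. -/
theorem lintegral_sub_mul_norm_rpow_le (hn : 2 ≤ n) {s r : ℝ} (hs0 : 0 < s) (hs : s < 1)
    (hr : 0 < r) {Ω : Set (Rn n)} (hΩ : IsOpen Ω) (hu : ContDiffOn ℝ 1 u Ω)
    (hB : Metric.ball 0 r ⊆ Ω) :
    ∫⁻ x in Metric.ball (0 : Rn n) r, ∫⁻ y in Metric.ball (0 : Rn n) r,
        ‖u x - u y‖ₑ * ENNReal.ofReal (‖x - y‖ ^ (-((n : ℝ) + s)))
      ≤ ENNReal.ofReal (sphereArea n * ((2 * r) ^ (1 - s) / (1 - s))) *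
        ∫⁻ x in Metric.ball (0 : Rn n) r, ‖fderiv ℝ u x‖ₑ := by
  set B := Metric.ball (0 : Rn n) r with hBdef
  set g : Rn n → ENNReal := B.indicator fun x => ‖fderiv ℝ u x‖ₑ with hg
  have hgm : Measurable g := (measurable_fderiv ℝ u).enorm.indicator measurableSet_ball
  set w : Rn n → ENNReal := (Metric.ball (0 : Rn n) (2 * r)).indicator
    fun z => ENNReal.ofReal (‖z‖ ^ (1 - ((n : ℝ) + s))) with hw
  have hwm : Measurable w := by
    refine Measurable.indicator ?_ measurableSet_ball
    fun_prop
  have hpt : ∀ x z : Rn n, x ∈ B → x + z ∈ B →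
      ‖u x - u (x + z)‖ₑ * ENNReal.ofReal (‖x - (x + z)‖ ^ (-((n : ℝ) + s)))
        ≤ w z * ∫⁻ t in Set.Icc (0 : ℝ) 1, g (x + t • z) := by
    intro x z hx hxz
    have hseg : ∀ t ∈ Set.Icc (0 : ℝ) 1, x + t • z ∈ B := by
      intro t ht
      have := (convex_ball (0 : Rn n) r).add_smul_sub_mem hx hxz ht
      rwa [add_sub_cancel_left] at this
    have hz2 : z ∈ Metric.ball (0 : Rn n) (2 * r) := by
      rw [mem_ball_zero_iff] at *
      calc ‖z‖ = ‖(x + z) - x‖ := by simp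
        _ ≤ ‖x + z‖ + ‖x‖ := norm_sub_le _ _
        _ < 2 * r := by
          have h1 : ‖x‖ < r := by simpa [hBdef] using hx
          have h2 : ‖x + z‖ < r := by simpa [hBdef] using hxz
          linarith
    have h1 := enorm_sub_le_lintegral_fderiv hΩ hu (x := x) (z := z) fun t ht => hB (hseg t ht)
    have h2 : ∫⁻ t in Set.Icc (0 : ℝ) 1, ‖fderiv ℝ u (x + t • z)‖ₑ
        = ∫⁻ t in Set.Icc (0 : ℝ) 1, g (x + t • z) :=
      setLIntegral_congr_fun measurableSet_Icc fun t ht => by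
        simp only [hg, Set.indicator_of_mem (hseg t ht)]
    rw [h2] at h1
    have h3 : ‖u x - u (x + z)‖ₑ = ‖u (x + z) - u x‖ₑ := by rw [← enorm_neg, neg_sub]
    have h4 : x - (x + z) = -z := by abel
    rw [h3, h4, norm_neg]
    by_cases hz : z = 0
    · subst hz; simp
    · have hz' : 0 < ‖z‖ := norm_pos_iff.2 hz
      have h5 : w z = ‖z‖ₑ * ENNReal.ofReal (‖z‖ ^ (-((n : ℝ) + s))) := by
        rw [hw, Set.indicator_of_mem hz2, ← ofReal_norm, ← ENNReal.ofReal_mul (norm_nonneg _),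
          sub_eq_add_neg, Real.rpow_add hz', Real.rpow_one]
      rw [h5]
      calc _ ≤ (‖z‖ₑ * ∫⁻ t in Set.Icc (0 : ℝ) 1, g (x + t • z)) *
            ENNReal.ofReal (‖z‖ ^ (-((n : ℝ) + s))) := by gcongr
        _ = _ := by ring
  have hgxt : Measurable fun p : (Rn n × Rn n) × ℝ => g (p.1.1 + p.2 • p.1.2) :=
    hgm.comp (by fun_prop)
  have hin : Measurable fun p : Rn n × Rn n => ∫⁻ t in Set.Icc (0 : ℝ) 1, g (p.1 + t • p.2) :=
    hgxt.lintegral_prod_right'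
  calc ∫⁻ x in B, ∫⁻ y in B, ‖u x - u y‖ₑ * ENNReal.ofReal (‖x - y‖ ^ (-((n : ℝ) + s)))
      ≤ ∫⁻ x in B, ∫⁻ z, w z * ∫⁻ t in Set.Icc (0 : ℝ) 1, g (x + t • z) := by
        refine setLIntegral_mono_ae' measurableSet_ball (Filter.Eventually.of_forall fun x hx => ?_)
        rw [← lintegral_indicator measurableSet_ball,
          ← lintegral_add_left_eq_self (μ := volume) _ x]
        refine lintegral_mono fun z => ?_
        by_cases hxz : x + z ∈ B
        · rw [Set.indicator_of_mem hxz]; exact hpt x z hx hxz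
        · rw [Set.indicator_of_notMem hxz]; exact zero_le
    -- Integrating over all `x` makes the shift by `t • z` harmless; the total of `g` is still the
    -- integral over the ball, as `g` vanishes outside.
    _ ≤ ∫⁻ x, ∫⁻ z, w z * ∫⁻ t in Set.Icc (0 : ℝ) 1, g (x + t • z) :=
        lintegral_mono' Measure.restrict_le_self le_rfl
    _ = ∫⁻ z, ∫⁻ x, w z * ∫⁻ t in Set.Icc (0 : ℝ) 1, g (x + t • z) :=
        lintegral_lintegral_swap ((hwm.comp measurable_snd).mul hin).aemeasurable
    _ = ∫⁻ z, w z * ∫⁻ x, g x := by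
        refine lintegral_congr fun z => ?_
        have hm : Measurable fun p : Rn n × ℝ => g (p.1 + p.2 • z) := hgm.comp (by fun_prop)
        rw [lintegral_const_mul _ hm.lintegral_prod_right', lintegral_lintegral_swap hm.aemeasurable]
        simp only [lintegral_add_right_eq_self]
        simp
    _ = _ := by
        rw [lintegral_mul_const _ hwm, hw, lintegral_indicator measurableSet_ball,
          lintegral_ball_norm_rpow hn hs0 hs (by linarith), hg,
          lintegral_indicator measurableSet_ball]

end DifferenceQuotient

/-! ### Truncations of the kernel, with bounds uniform in the scale. -/

section TruncatedKernel

variable {n : ℕ} {s lam Lam c t : ℝ} {K χ : Rn n → ℝ} {e : Rn n}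

theorem KernelClassL2.div_le (hs0 : 0 < s) (hLam : 0 < Lam) {z : Rn n} :
    (2 - s) * Lam / ‖z‖ ^ ((n : ℝ) + s) ≤ 2 * Lam * ‖z‖ ^ (-((n : ℝ) + s)) := by
  rw [Real.rpow_neg (norm_nonneg z), div_eq_mul_inv]
  have : 0 ≤ ‖z‖ ^ ((n : ℝ) + s) := Real.rpow_nonneg (norm_nonneg z) _
  gcongr
  linarith

theorem truncation_dirDeriv (hχ : IsTruncation χ c) (hK : KernelClassL2 n s lam Lam K)
    {z : Rn n} (hz : z ≠ 0) :
    dirDeriv e (fun z => χ (t • z) * K z) z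
      = χ (t • z) * dirDeriv e K z + t * dirDeriv e χ (t • z) * K z := by
  have hχd := hχ.contDiff.differentiable two_ne_zero
  have hKd : DifferentiableAt ℝ K z :=
    (hK.contDiff.contDiffAt (isOpen_compl_singleton.mem_nhds hz)).differentiableAt two_ne_zero
  rw [dirDeriv_fun_mul (f := fun z => χ (t • z)) (by fun_prop) hKd, dirDeriv_comp_smul]

theorem truncation_dirDeriv2 (hχ : IsTruncation χ c) (hK : KernelClassL2 n s lam Lam K)
    {z : Rn n} (hz : z ≠ 0) :
    dirDeriv e (dirDeriv e (fun z => χ (t • z) * K z)) z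
      = χ (t • z) * dirDeriv e (dirDeriv e K) z + 2 * (t * dirDeriv e χ (t • z)) * dirDeriv e K z
        + t ^ 2 * dirDeriv e (dirDeriv e χ) (t • z) * K z := by
  have hev : dirDeriv e (fun z => χ (t • z) * K z) =ᶠ[nhds z]
      fun z => χ (t • z) * dirDeriv e K z + (t * dirDeriv e χ (t • z)) * K z := by
    filter_upwards [isOpen_compl_singleton.mem_nhds hz] with y hy
    exact truncation_dirDeriv hχ hK hy
  have hχd := hχ.contDiff.differentiable two_ne_zero
  have hχ1 : ContDiff ℝ 1 (dirDeriv e χ) :=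
    (hχ.contDiff.fderiv_right (m := 1) (by norm_num)).clm_apply contDiff_const
  have hχ1d := hχ1.differentiable one_ne_zero
  have hKat := hK.contDiff.contDiffAt (isOpen_compl_singleton.mem_nhds hz)
  have hKd : DifferentiableAt ℝ K z := hKat.differentiableAt two_ne_zero
  have hK1d : DifferentiableAt ℝ (dirDeriv e K) z :=
    ((hKat.fderiv_right (m := 1) (by norm_num)).clm_apply contDiffAt_const).differentiableAt
      one_ne_zero
  have hd1 : DifferentiableAt ℝ (fun z => χ (t • z)) z := by fun_prop
  have hd2 : DifferentiableAt ℝ (fun z => dirDeriv e χ (t • z)) z :=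
    (hχ1d _).comp z (by fun_prop)
  have hd3 : DifferentiableAt ℝ (fun z => t * dirDeriv e χ (t • z)) z := hd2.const_mul t
  have h1 : dirDeriv e (dirDeriv e (fun z => χ (t • z) * K z)) z
      = dirDeriv e (fun z => χ (t • z) * dirDeriv e K z) z
        + dirDeriv e (fun z => (t * dirDeriv e χ (t • z)) * K z) z := by
    have hadd := fderiv_add (hd1.mul hK1d) (hd3.mul hKd)
    have hev' := congrArg (fun L : Rn n →L[ℝ] ℝ => L e) (hev.fderiv_eq.trans hadd)
    exact hev'
  have h2 : dirDeriv e (fun z => t * dirDeriv e χ (t • z)) z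
      = t * (t * dirDeriv e (dirDeriv e χ) (t • z)) := by
    rw [← dirDeriv_comp_smul]
    simp only [dirDeriv] at hd2 ⊢
    rw [fderiv_const_mul hd2]
    rfl
  rw [h1, dirDeriv_fun_mul hd1 hK1d, dirDeriv_fun_mul hd3 hKd, dirDeriv_comp_smul, h2]
  ring

/-- The bounds on `χ` are scale invariant, so `t` disappears. In the worst case the Leibniz rule
gives `1 + 2c + c ≤ 4c`, and `2 - s ≤ 2` gives the other factor `2`. -/
theorem truncation_bounds (hχ : IsTruncation χ c) (hK : KernelClassL2 n s lam Lam K)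
    (hlam : 0 < lam) (hLam : 0 < Lam) (hs0 : 0 < s) (hs : s < 1) (ht : 0 < t) (he : ‖e‖ = 1)
    {z : Rn n} (hz : z ≠ 0) :
    |χ (t • z) * K z| ≤ 8 * c * Lam * ‖z‖ ^ (-((n : ℝ) + s)) ∧
    ‖z‖ * |dirDeriv e (fun z => χ (t • z) * K z) z| ≤ 8 * c * Lam * ‖z‖ ^ (-((n : ℝ) + s)) ∧
    ‖z‖ ^ 2 * |dirDeriv e (dirDeriv e (fun z => χ (t • z) * K z)) z|
      ≤ 8 * c * Lam * ‖z‖ ^ (-((n : ℝ) + s)) := by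
  have hc := hχ.one_le
  have a0 := hχ.abs_le_one (t • z)
  obtain ⟨a1, a2⟩ := hχ.deriv_le e he (t • z)
  rw [norm_smul, Real.norm_of_nonneg ht.le] at a1 a2
  have b0 := hK.abs_le hlam hs hs0 hLam hz
  have b1 := (hK.deriv_le z hz e he).trans (KernelClassL2.div_le hs0 hLam)
  have b2 := (hK.deriv2_le z hz e he).trans (KernelClassL2.div_le hs0 hLam)
  change ‖z‖ * |dirDeriv e K z| ≤ _ at b1
  change ‖z‖ ^ 2 * |dirDeriv e (dirDeriv e K) z| ≤ _ at b2
  rw [truncation_dirDeriv hχ hK hz, truncation_dirDeriv2 hχ hK hz]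
  set M := 2 * Lam * ‖z‖ ^ (-((n : ℝ) + s)) with hM
  have hM0 : 0 ≤ M := (abs_nonneg _).trans b0
  have hMe : 8 * c * Lam * ‖z‖ ^ (-((n : ℝ) + s)) = 4 * c * M := by rw [hM]; ring
  have hcM : M ≤ c * M := le_mul_of_one_le_left hM0 hc
  rw [hMe]
  set X0 := χ (t • z)
  set X1 := dirDeriv e χ (t • z)
  set X2 := dirDeriv e (dirDeriv e χ) (t • z)
  set K0 := K z
  set K1 := dirDeriv e K z
  set K2 := dirDeriv e (dirDeriv e K) z
  set ζ := ‖z‖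
  have hζ : 0 ≤ ζ := norm_nonneg z
  have p00 : |X0| * |K0| ≤ 1 * M := mul_le_mul a0 b0 (abs_nonneg _) zero_le_one
  have p01 : |X0| * (ζ * |K1|) ≤ 1 * M := mul_le_mul a0 b1 (by positivity) zero_le_one
  have p02 : |X0| * (ζ ^ 2 * |K2|) ≤ 1 * M := mul_le_mul a0 b2 (by positivity) zero_le_one
  have p10 : (t * ζ * |X1|) * |K0| ≤ c * M := mul_le_mul a1 b0 (abs_nonneg _) (by linarith)
  have p11 : (t * ζ * |X1|) * (ζ * |K1|) ≤ c * M :=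
    mul_le_mul a1 b1 (by positivity) (by linarith)
  have p20 : ((t * ζ) ^ 2 * |X2|) * |K0| ≤ c * M := mul_le_mul a2 b0 (abs_nonneg _) (by linarith)
  refine ⟨?_, ?_, ?_⟩
  · rw [abs_mul]; linarith
  · calc ζ * |X0 * K1 + t * X1 * K0| ≤ ζ * (|X0 * K1| + |t * X1 * K0|) := by
          gcongr; exact abs_add_le _ _
      _ = |X0| * (ζ * |K1|) + (t * ζ * |X1|) * |K0| := by
          simp only [abs_mul, abs_of_pos ht]; ring
      _ ≤ _ := by linarith
  · calc ζ ^ 2 * |X0 * K2 + 2 * (t * X1) * K1 + t ^ 2 * X2 * K0|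
        ≤ ζ ^ 2 * (|X0 * K2| + |2 * (t * X1) * K1| + |t ^ 2 * X2 * K0|) := by
          gcongr; exact abs_add_three _ _ _
      _ = |X0| * (ζ ^ 2 * |K2|) + 2 * ((t * ζ * |X1|) * (ζ * |K1|))
          + ((t * ζ) ^ 2 * |X2|) * |K0| := by
          simp only [abs_mul, abs_of_pos ht, abs_pow, abs_two]; ring
      _ ≤ _ := by linarith

theorem truncation_eventuallyEq_zero (hχ : IsTruncation χ c) (ht : 0 < t) {z : Rn n}
    (hz : ‖z‖ < t⁻¹) : (fun z => χ (t • z) * K z) =ᶠ[nhds z] fun _ => 0 := by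
  filter_upwards [(isOpen_lt continuous_norm continuous_const).mem_nhds hz] with y hy
  rw [hχ.zero_near, zero_mul]
  rw [norm_smul, Real.norm_of_nonneg ht.le]
  calc t * ‖y‖ ≤ t * t⁻¹ := by gcongr
    _ = 1 := mul_inv_cancel₀ ht.ne'

theorem truncation_contDiff (hχ : IsTruncation χ c) (hK : KernelClassL2 n s lam Lam K)
    (ht : 0 < t) : ContDiff ℝ 2 (fun z => χ (t • z) * K z) := by
  rw [contDiff_iff_contDiffAt]
  intro z
  by_cases hz : z = 0
  · have h := truncation_eventuallyEq_zero (K := K) hχ ht (z := z) (by rw [hz]; simpa using ht)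
    exact contDiffAt_const.congr_of_eventuallyEq h
  · have hKat := hK.contDiff.contDiffAt (isOpen_compl_singleton.mem_nhds hz)
    have hχt : ContDiff ℝ 2 fun z : Rn n => χ (t • z) :=
      hχ.contDiff.comp (contDiff_const_smul t)
    exact hχt.contDiffAt.mul hKat

theorem dirDeriv_eventuallyEq_zero {f : Rn n → ℝ} {z : Rn n} (h : f =ᶠ[nhds z] fun _ => 0) :
    dirDeriv e f =ᶠ[nhds z] fun _ => 0 := by
  filter_upwards [h.eventuallyEq_nhds] with y hy
  simp only [dirDeriv, hy.fderiv_eq]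
  simp

/-- On the support `|z| ≥ 1/t`, so dividing by `|z|` or `|z|²` costs powers of `t`. That is
harmless: only integrability is needed here, not uniformity. -/
theorem smoothKernel_truncation (hn : 2 ≤ n) (hχ : IsTruncation χ c)
    (hK : KernelClassL2 n s lam Lam K) (hlam : 0 < lam) (hLam : 0 < Lam) (hs0 : 0 < s)
    (hs : s < 1) (ht : 0 < t) (he : ‖e‖ = 1) :
    SmoothKernel e (fun z => χ (t • z) * K z) := by
  have hC := truncation_contDiff hχ hK ht
  have hC1 : ContDiff ℝ 1 (dirDeriv e (fun z => χ (t • z) * K z)) :=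
    (hC.fderiv_right (m := 1) (by norm_num)).clm_apply contDiff_const
  have hz0 : ∀ z : Rn n, ‖z‖ < t⁻¹ → (fun z => χ (t • z) * K z) =ᶠ[nhds z] fun _ => 0 :=
    fun z hz => truncation_eventuallyEq_zero hχ ht hz
  have ht' : 0 < t⁻¹ := inv_pos.2 ht
  have hne : ∀ z : Rn n, t⁻¹ ≤ ‖z‖ → z ≠ 0 := fun z hz => norm_pos_iff.1 (ht'.trans_le hz)
  refine ⟨hC, fun z => ?_, ?_, ?_, ?_⟩
  · beta_reduce; rw [smul_neg, hχ.even, ← hK.even]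
  · exact integrable_of_le_norm_rpow hn hs0 ht' hC.continuous.aestronglyMeasurable
      (fun z hz => (hz0 z hz).eq_of_nhds)
      fun z hz => (truncation_bounds hχ hK hlam hLam hs0 hs ht he (hne z hz)).1
  · refine integrable_of_le_norm_rpow hn hs0 ht' (C := t * (8 * c * Lam))
      hC1.continuous.aestronglyMeasurable
      (fun z hz => (dirDeriv_eventuallyEq_zero (hz0 z hz)).eq_of_nhds) fun z hz => ?_
    have h := (truncation_bounds hχ hK hlam hLam hs0 hs ht he (hne z hz)).2.1
    set D := |dirDeriv e (fun z => χ (t • z) * K z) z|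
    have hD : 0 ≤ D := abs_nonneg _
    calc D = t * (t⁻¹ * D) := by field_simp
      _ ≤ t * (‖z‖ * D) := by gcongr
      _ ≤ _ := by rw [mul_assoc]; gcongr
  · refine integrable_of_le_norm_rpow hn hs0 ht' (C := t ^ 2 * (8 * c * Lam))
      (hC1.continuous_dirDeriv e).aestronglyMeasurable
      (fun z hz => (dirDeriv_eventuallyEq_zero
        (dirDeriv_eventuallyEq_zero (hz0 z hz))).eq_of_nhds) fun z hz => ?_
    have h := (truncation_bounds hχ hK hlam hLam hs0 hs ht he (hne z hz)).2.2
    set D := |dirDeriv e (dirDeriv e (fun z => χ (t • z) * K z)) z|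
    have hD : 0 ≤ D := abs_nonneg _
    calc D = t ^ 2 * (t⁻¹ ^ 2 * D) := by field_simp
      _ ≤ t ^ 2 * (‖z‖ ^ 2 * D) := by gcongr
      _ ≤ _ := by rw [mul_assoc]; gcongr

end TruncatedKernel

/-! ### The Sobolev energy and the bound by it. -/

/-- The integral of `|u(x) - u(y)|² |x - y|^{-n-s}` over `x ∈ B_σ` and `y ∈ ℝⁿ`. -/
noncomputable def sobolevEnergy {n : ℕ} (s σ : ℝ) (u : Rn n → ℝ) : ENNReal :=
  ∫⁻ p in Metric.ball (0 : Rn n) σ ×ˢ (Set.univ : Set (Rn n)),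
    ENNReal.ofReal ((u p.1 - u p.2) ^ 2 * ‖p.1 - p.2‖ ^ (-((n : ℝ) + s)))

section Energy

variable {n : ℕ} {s : ℝ} {u : Rn n → ℝ}

theorem aemeasurable_sobolev_integrand (s : ℝ) (hu : AEStronglyMeasurable u volume) :
    AEMeasurable (fun p : Rn n × Rn n =>
      ENNReal.ofReal ((u p.1 - u p.2) ^ 2 * ‖p.1 - p.2‖ ^ (-((n : ℝ) + s)))) := by
  have h1 : AEMeasurable (fun p : Rn n × Rn n => u p.1) :=
    (AEStronglyMeasurable.comp_fst (ν := volume) hu).aemeasurable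
  have h2 : AEMeasurable (fun p : Rn n × Rn n => u p.2) :=
    (AEStronglyMeasurable.comp_snd (μ := volume) hu).aemeasurable
  have h3 : Measurable (fun p : Rn n × Rn n => ‖p.1 - p.2‖ ^ (-((n : ℝ) + s))) := by fun_prop
  exact (((h1.sub h2).pow_const 2).mul h3.aemeasurable).ennreal_ofReal

/-- For `y` in the larger ball, `|u| ≤ 1` gives `(u(x) - u(y))² ≤ 2|u(x) - u(y)|`, which the
gradient controls. Otherwise `|x - y| ≥ r - σ`, and the trivial bound `4` meets the integrable tail
of the kernel. -/
theorem sobolevEnergy_le (hn : 2 ≤ n) (hs0 : 0 < s) (hs : s < 1) {σ r : ℝ} (hσ : 0 < σ)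
    (hσr : σ < r) {Ω : Set (Rn n)} (hΩ : IsOpen Ω) (hu : ContDiffOn ℝ 1 u Ω)
    (hB : Metric.ball 0 r ⊆ Ω) (hum : AEStronglyMeasurable u volume) (hu1 : ∀ x, |u x| ≤ 1) :
    sobolevEnergy s σ u ≤ 2 * (ENNReal.ofReal (sphereArea n * ((2 * r) ^ (1 - s) / (1 - s))) *
        ∫⁻ x in Metric.ball (0 : Rn n) r, ‖fderiv ℝ u x‖ₑ)
      + 4 * ENNReal.ofReal (sphereArea n * ((r - σ) ^ (-s) / s)) *
        volume (Metric.ball (0 : Rn n) σ) := by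
  have hd : 0 < r - σ := by linarith
  have hm := aemeasurable_sobolev_integrand s hum
  set F : Rn n → Rn n → ENNReal := fun x y =>
    ENNReal.ofReal ((u x - u y) ^ 2 * ‖x - y‖ ^ (-((n : ℝ) + s))) with hF
  have hdiff : ∀ x y, |u x - u y| ≤ 2 := fun x y => by
    calc |u x - u y| ≤ |u x| + |u y| := abs_sub _ _
      _ ≤ 2 := by linarith [hu1 x, hu1 y]
  have hF1 : ∀ x y, F x y ≤ 2 * (‖u x - u y‖ₑ * ENNReal.ofReal (‖x - y‖ ^ (-((n : ℝ) + s)))) := by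
    intro x y
    have hw : 0 ≤ ‖x - y‖ ^ (-((n : ℝ) + s)) := Real.rpow_nonneg (norm_nonneg _) _
    have h2 : 2 * ENNReal.ofReal (‖u x - u y‖ * ‖x - y‖ ^ (-((n : ℝ) + s)))
        = ENNReal.ofReal (2 * (‖u x - u y‖ * ‖x - y‖ ^ (-((n : ℝ) + s)))) := by
      rw [ENNReal.ofReal_mul zero_le_two, ENNReal.ofReal_ofNat]
    rw [← ofReal_norm, ← ENNReal.ofReal_mul (norm_nonneg _), h2]
    refine ENNReal.ofReal_le_ofReal ?_
    rw [← mul_assoc, ← sq_abs, Real.norm_eq_abs]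
    refine mul_le_mul_of_nonneg_right ?_ hw
    nlinarith [hdiff x y, abs_nonneg (u x - u y)]
  have hF2 : ∀ x y, F x y ≤ 4 * ENNReal.ofReal (‖x - y‖ ^ (-((n : ℝ) + s))) := by
    intro x y
    have hw : 0 ≤ ‖x - y‖ ^ (-((n : ℝ) + s)) := Real.rpow_nonneg (norm_nonneg _) _
    have h2 : (4 : ENNReal) = ENNReal.ofReal 4 := by simp
    rw [h2, ← ENNReal.ofReal_mul (by norm_num)]
    refine ENNReal.ofReal_le_ofReal (mul_le_mul_of_nonneg_right ?_ hw)
    rw [← sq_abs]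
    nlinarith [hdiff x y, abs_nonneg (u x - u y)]
  have hfar : ∀ x ∈ Metric.ball (0 : Rn n) σ, ∫⁻ y in (Metric.ball (0 : Rn n) r)ᶜ, F x y
      ≤ 4 * ENNReal.ofReal (sphereArea n * ((r - σ) ^ (-s) / s)) := by
    intro x hx
    rw [← lintegral_norm_rpow_far hn hs0 hd, ← lintegral_const_mul' _ _ (by simp),
      ← lintegral_indicator measurableSet_ball.compl,
      ← lintegral_indicator (measurableSet_le measurable_const measurable_norm),
      ← lintegral_sub_left_eq_self (μ := volume) (fun z => Set.indicator {z : Rn n | r - σ ≤ ‖z‖}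
        (fun z => 4 * ENNReal.ofReal (‖z‖ ^ (-((n : ℝ) + s)))) z) x]
    refine lintegral_mono fun y => ?_
    by_cases hy : y ∈ (Metric.ball (0 : Rn n) r)ᶜ
    · have hxy : x - y ∈ {z : Rn n | r - σ ≤ ‖z‖} := by
        have h1 : ‖x‖ < σ := by simpa using hx
        have h2 : r ≤ ‖y‖ := by simpa using hy
        have h3 : ‖y‖ ≤ ‖x‖ + ‖x - y‖ := norm_le_norm_add_norm_sub x y
        show r - σ ≤ ‖x - y‖
        linarith
      rw [Set.indicator_of_mem hy, Set.indicator_of_mem hxy]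
      exact hF2 x y
    · rw [Set.indicator_of_notMem hy]; exact zero_le
  have hsub : Metric.ball (0 : Rn n) σ ⊆ Metric.ball 0 r := Metric.ball_subset_ball hσr.le
  have hprod : sobolevEnergy s σ u = ∫⁻ x in Metric.ball (0 : Rn n) σ, ∫⁻ y, F x y := by
    unfold sobolevEnergy
    rw [Measure.volume_eq_prod, ← Measure.prod_restrict, Measure.restrict_univ, lintegral_prod]
    refine hm.mono_measure ?_
    rw [Measure.volume_eq_prod]
    exact Measure.prod_mono Measure.restrict_le_self le_rfl
  rw [hprod]
  calc ∫⁻ x in Metric.ball (0 : Rn n) σ, ∫⁻ y, F x y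
      ≤ ∫⁻ x in Metric.ball (0 : Rn n) σ, ((∫⁻ y in Metric.ball (0 : Rn n) r, F x y)
          + 4 * ENNReal.ofReal (sphereArea n * ((r - σ) ^ (-s) / s))) := by
        refine setLIntegral_mono_ae' measurableSet_ball
          (Filter.Eventually.of_forall fun x hx => ?_)
        rw [← lintegral_add_compl _ (measurableSet_ball (x := (0 : Rn n)) (ε := r))]
        gcongr
        exact hfar x hx
    _ = (∫⁻ x in Metric.ball (0 : Rn n) σ, ∫⁻ y in Metric.ball (0 : Rn n) r, F x y)
          + 4 * ENNReal.ofReal (sphereArea n * ((r - σ) ^ (-s) / s)) *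
            volume (Metric.ball (0 : Rn n) σ) := by
        rw [lintegral_add_right _ measurable_const, setLIntegral_const]
    _ ≤ _ := by
        gcongr
        refine le_trans ?_ (mul_le_mul_right
          (lintegral_sub_mul_norm_rpow_le hn hs0 hs (hσ.trans hσr) hΩ hu hB) 2)
        rw [← lintegral_const_mul' _ _ (by simp)]
        refine (lintegral_mono' (Measure.restrict_mono hsub le_rfl) le_rfl).trans ?_
        refine lintegral_mono fun x => ?_
        rw [← lintegral_const_mul' _ _ (by simp)]
        exact lintegral_mono fun y => hF1 x y

/-- Each derivative missing from the kernel falls on `η`, and each factor `η(x) - η(y)` supplies a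
power of `|x - y|`. The three terms contribute `½ + 2 + 1 ≤ 4`. -/
theorem abs_cutoffKernel_le {e : Rn n} {k η : Rn n → ℝ} {A D : ℝ}
    (hη : ∀ x y, |η x - η y| ≤ A * ‖x - y‖) (hη1 : ∀ x, |dirDeriv e η x| ≤ A)
    (hk : ∀ z : Rn n, z ≠ 0 → |k z| ≤ D * ‖z‖ ^ (-((n : ℝ) + s)) ∧
      ‖z‖ * |dirDeriv e k z| ≤ D * ‖z‖ ^ (-((n : ℝ) + s)) ∧
      ‖z‖ ^ 2 * |dirDeriv e (dirDeriv e k) z| ≤ D * ‖z‖ ^ (-((n : ℝ) + s)))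
    {p : Rn n × Rn n} (hp : p.1 ≠ p.2) :
    |cutoffKernel e k η p| ≤ 4 * A ^ 2 * D * ‖p.1 - p.2‖ ^ (-((n : ℝ) + s)) := by
  obtain ⟨k0, k1, k2⟩ := hk _ (sub_ne_zero.2 hp)
  have hA : 0 ≤ A := (abs_nonneg _).trans (hη1 p.1)
  have a1 := hη1 p.1
  have a2 := hη1 p.2
  have a0 := hη p.1 p.2
  unfold cutoffKernel
  set M := D * ‖p.1 - p.2‖ ^ (-((n : ℝ) + s)) with hM
  have hM' : 4 * A ^ 2 * D * ‖p.1 - p.2‖ ^ (-((n : ℝ) + s)) = 4 * A ^ 2 * M := by rw [hM]; ring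
  have hM0 : 0 ≤ M := (abs_nonneg _).trans k0
  rw [hM']
  set ζ := ‖p.1 - p.2‖
  have hζ : 0 ≤ ζ := norm_nonneg _
  set K0 := k (p.1 - p.2)
  set K1 := dirDeriv e k (p.1 - p.2)
  set K2 := dirDeriv e (dirDeriv e k) (p.1 - p.2)
  have e0 : |dirDeriv e η p.1| * |dirDeriv e η p.2| * |K0| ≤ A * A * M :=
    mul_le_mul (mul_le_mul a1 a2 (abs_nonneg _) hA) k0 (abs_nonneg _) (by positivity)
  have e1 : |η p.1 - η p.2| * |dirDeriv e η p.1 + dirDeriv e η p.2| * |K1|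
      ≤ (A * (2 * A)) * M := by
    have h : |dirDeriv e η p.1 + dirDeriv e η p.2| ≤ 2 * A :=
      (abs_add_le _ _).trans (by linarith)
    calc _ ≤ (A * ζ) * (2 * A) * |K1| := by gcongr
      _ = (A * (2 * A)) * (ζ * |K1|) := by ring
      _ ≤ _ := by gcongr
  have e2 : |η p.1 - η p.2| ^ 2 * |K2| ≤ A ^ 2 * M := by
    calc _ ≤ (A * ζ) ^ 2 * |K2| := by gcongr
      _ = A ^ 2 * (ζ ^ 2 * |K2|) := by ring
      _ ≤ _ := by gcongr
  refine (abs_add_three _ _ _).trans ?_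
  simp only [abs_mul, abs_pow]
  rw [abs_of_pos (by norm_num : (0 : ℝ) < 1 / 2)]
  nlinarith [mul_nonneg (mul_nonneg hA hA) hM0]

theorem cutoffKernel_eq_zero {e : Rn n} {k η : Rn n → ℝ} {p : Rn n × Rn n}
    (h1 : p.1 ∉ tsupport η) (h2 : p.2 ∉ tsupport η) : cutoffKernel e k η p = 0 := by
  have hd : ∀ x, x ∉ tsupport η → dirDeriv e η x = 0 := fun x hx => by
    have : fderiv ℝ η x = 0 := Function.notMem_support.1 fun h => hx (support_fderiv_subset ℝ h)
    simp [dirDeriv, this]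
  simp only [cutoffKernel, image_eq_zero_of_notMem_tsupport h1,
    image_eq_zero_of_notMem_tsupport h2, hd _ h1, hd _ h2]
  ring

/-- The cutoff kernel vanishes unless one of the two points lies in `supp η`. The energy controls
each of the two possibilities, whence `8 = 2 · 4`. -/
theorem integral_sq_mul_cutoffKernel_le {e : Rn n} {k η : Rn n → ℝ} {A D σ : ℝ} (hD : 0 ≤ D)
    (hη : ∀ x y, |η x - η y| ≤ A * ‖x - y‖) (hη1 : ∀ x, |dirDeriv e η x| ≤ A)
    (hk : ∀ z : Rn n, z ≠ 0 → |k z| ≤ D * ‖z‖ ^ (-((n : ℝ) + s)) ∧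
      ‖z‖ * |dirDeriv e k z| ≤ D * ‖z‖ ^ (-((n : ℝ) + s)) ∧
      ‖z‖ ^ 2 * |dirDeriv e (dirDeriv e k) z| ≤ D * ‖z‖ ^ (-((n : ℝ) + s)))
    (hs : tsupport η ⊆ Metric.ball 0 σ) (hum : AEStronglyMeasurable u volume)
    (hN : sobolevEnergy s σ u ≠ ⊤) :
    ∫ p : Rn n × Rn n, (u p.1 - u p.2) ^ 2 * cutoffKernel e k η p
      ≤ 8 * A ^ 2 * D * (sobolevEnergy s σ u).toReal := by
  set F : Rn n × Rn n → ENNReal := fun p =>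
    ENNReal.ofReal ((u p.1 - u p.2) ^ 2 * ‖p.1 - p.2‖ ^ (-((n : ℝ) + s))) with hF
  have hFm : AEMeasurable F := aemeasurable_sobolev_integrand s hum
  have hms : MeasurableSet (Metric.ball (0 : Rn n) σ ×ˢ (Set.univ : Set (Rn n))) :=
    measurableSet_ball.prod MeasurableSet.univ
  set F1 : Rn n × Rn n → ENNReal :=
    (Metric.ball (0 : Rn n) σ ×ˢ (Set.univ : Set (Rn n))).indicator F with hF1
  have hF1m : AEMeasurable F1 := hFm.indicator hms
  have hI1 : ∫⁻ p, F1 p = sobolevEnergy s σ u := lintegral_indicator hms _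
  have hI2 : ∫⁻ p : Rn n × Rn n, F1 p.swap = sobolevEnergy s σ u := by
    rw [← hI1, Measure.volume_eq_prod]
    exact lintegral_prod_swap _
  have hpt : ∀ p : Rn n × Rn n,
      ENNReal.ofReal ‖(u p.1 - u p.2) ^ 2 * cutoffKernel e k η p‖
        ≤ ENNReal.ofReal (4 * A ^ 2 * D) * (F1 p + F1 p.swap) := by
    intro p
    -- On the diagonal nothing is known of the kernel, but the difference of `u` vanishes.
    by_cases hp : p.1 = p.2
    · simp [hp]
    · have hb : ENNReal.ofReal ‖(u p.1 - u p.2) ^ 2 * cutoffKernel e k η p‖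
          ≤ ENNReal.ofReal (4 * A ^ 2 * D) * F p := by
        rw [hF, ← ENNReal.ofReal_mul (by positivity), norm_mul, Real.norm_of_nonneg (sq_nonneg _)]
        refine ENNReal.ofReal_le_ofReal ?_
        have := mul_le_mul_of_nonneg_left (abs_cutoffKernel_le hη hη1 hk hp)
          (sq_nonneg (u p.1 - u p.2))
        rw [Real.norm_eq_abs]
        linarith
      by_cases h1 : p.1 ∈ Metric.ball (0 : Rn n) σ
      · have : F1 p = F p := Set.indicator_of_mem (by exact ⟨h1, Set.mem_univ _⟩) F
        rw [this]
        exact hb.trans (by gcongr; exact le_self_add)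
      · by_cases h2 : p.2 ∈ Metric.ball (0 : Rn n) σ
        · have h3 : F1 p.swap = F p.swap := Set.indicator_of_mem (by exact ⟨h2, Set.mem_univ _⟩) F
          have h4 : F p.swap = F p := by
            simp only [hF, Prod.fst_swap, Prod.snd_swap, norm_sub_rev p.2 p.1]
            congr 2; ring
          rw [h3, h4]
          exact hb.trans (by gcongr; exact le_add_self)
        · rw [cutoffKernel_eq_zero (fun h => h1 (hs h)) fun h => h2 (hs h)]
          simp
  refine (le_abs_self _).trans ?_
  rw [← Real.norm_eq_abs]
  refine (norm_integral_le_lintegral_norm _).trans ?_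
  have hle := lintegral_mono (μ := volume) hpt
  rw [lintegral_const_mul' _ _ ENNReal.ofReal_ne_top, lintegral_add_left' hF1m, hI1, hI2] at hle
  refine (ENNReal.toReal_mono (ENNReal.mul_ne_top ENNReal.ofReal_ne_top
    (ENNReal.add_ne_top.2 ⟨hN, hN⟩)) hle).trans_eq ?_
  rw [ENNReal.toReal_mul, ENNReal.toReal_add hN hN, ENNReal.toReal_ofReal (by positivity)]
  ring

end Energy

/-! ### Domination by `min(1,|z|) |z|^{-n-s}`. -/

section LocalIntegrability

variable {n : ℕ} {s : ℝ}

theorem integrable_of_le_indicator (hn : 2 ≤ n) (hs0 : 0 < s) (hs : s < 1) {S : Set (Rn n)}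
    (hS : IsCompact S) {f : Rn n × Rn n → ℝ} (hf : AEStronglyMeasurable f volume) {C : ℝ}
    (hb : ∀ p : Rn n × Rn n, |f p| ≤ C * ((S.indicator 1 p.1 + S.indicator 1 p.2) *
      (min 1 ‖p.1 - p.2‖ * ‖p.1 - p.2‖ ^ (-((n : ℝ) + s))))) : Integrable f := by
  have hk := integrable_min_mul_norm_rpow hn hs0 hs
  have hi : Integrable (S.indicator (1 : Rn n → ℝ)) :=
    (integrable_indicator_iff hS.measurableSet).2
      (integrableOn_const (hs := hS.measure_lt_top.ne) (C := (1 : ℝ)))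
  have h1 := integrable_kernelForm_left hk hi (BddMeas.const 1)
  have h2 := integrable_kernelForm_right hk (BddMeas.const 1) hi
  refine Integrable.mono' ((h1.add h2).const_mul C) hf (Filter.Eventually.of_forall fun p => ?_)
  refine (hb p).trans_eq ?_
  simp only [Pi.add_apply]
  ring

theorem one_le_indicator_add {S : Set (Rn n)} {p : Rn n × Rn n} (h : p.1 ∈ S ∨ p.2 ∈ S) :
    (1 : ℝ) ≤ S.indicator 1 p.1 + S.indicator 1 p.2 := by
  have h1 : ∀ x, (0 : ℝ) ≤ S.indicator 1 x := fun x => Set.indicator_nonneg (fun _ _ => by simp) x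
  rcases h with h | h
  · rw [Set.indicator_of_mem h]; simpa using h1 p.2
  · rw [Set.indicator_of_mem h (f := (1 : Rn n → ℝ))]; simpa using h1 p.1

/-- Near the compact set `u` is Lipschitz on small balls; at larger distance boundedness suffices,
so `y` is unrestricted. -/
theorem exists_abs_sub_le_min {Ω S : Set (Rn n)} {u : Rn n → ℝ} (hΩ : IsOpen Ω)
    (hS : IsCompact S) (hSΩ : S ⊆ Ω) (hu : ContDiffOn ℝ 1 u Ω) (hu1 : ∀ x, |u x| ≤ 1) :
    ∃ C, 0 ≤ C ∧ ∀ x ∈ S, ∀ y, |u x - u y| ≤ C * min 1 ‖x - y‖ := by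
  obtain ⟨δ, hδ, hδΩ⟩ := hS.exists_cthickening_subset_open hΩ hSΩ
  have hcomp : IsCompact (Metric.cthickening δ S) := hS.cthickening
  obtain ⟨M, hM⟩ := hcomp.exists_bound_of_continuousOn
    ((hu.continuousOn_fderiv_of_isOpen hΩ le_rfl).mono hδΩ)
  have h2 : ∀ x y, |u x - u y| ≤ 2 := fun x y =>
    (abs_sub _ _).trans (by linarith [hu1 x, hu1 y])
  have hm : 0 < min 1 δ := lt_min one_pos hδ
  -- The three summands serve, in order, `|x - y| ≤ min 1 δ`, the range `1 ≤ |x - y| ≤ δ`, and `|x -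
  -- y| > δ`.
  refine ⟨|M| + 2 + 2 / min 1 δ, by positivity, fun x hx y => ?_⟩
  have hpos : 0 ≤ min 1 ‖x - y‖ := le_min zero_le_one (norm_nonneg _)
  rcases le_or_gt ‖x - y‖ δ with h | h
  · have hball : Metric.closedBall x δ ⊆ Metric.cthickening δ S :=
      Metric.closedBall_subset_cthickening hx δ
    have hl : |u x - u y| ≤ |M| * ‖x - y‖ := by
      refine (convex_closedBall x δ).norm_image_sub_le_of_norm_fderiv_le (𝕜 := ℝ) (f := u)
        (fun z hz => (hu.contDiffAt (hΩ.mem_nhds (hδΩ (hball hz)))).differentiableAt one_ne_zero)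
        (fun z hz => (hM z (hball hz)).trans (le_abs_self M)) ?_ ?_
      · rw [Metric.mem_closedBall, dist_comm, dist_eq_norm]; exact h
      · exact Metric.mem_closedBall_self hδ.le
    have hm2 : 0 ≤ 2 / min 1 δ * min 1 ‖x - y‖ := by positivity
    rcases le_total 1 ‖x - y‖ with h1 | h1
    · rw [min_eq_left h1] at hm2 ⊢
      nlinarith [h2 x y, abs_nonneg M]
    · rw [min_eq_right h1] at hm2 ⊢
      nlinarith [h2 x y, abs_nonneg M, norm_nonneg (x - y)]
  · have h3 : min 1 δ ≤ min 1 ‖x - y‖ := min_le_min_left 1 h.le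
    have h4 : 2 ≤ 2 / min 1 δ * min 1 ‖x - y‖ := by
      rw [div_mul_eq_mul_div, le_div_iff₀ hm]
      linarith
    nlinarith [h2 x y, abs_nonneg M]

theorem sq_le_mul_min {a B L ζ : ℝ} (h1 : |a| ≤ B) (h2 : |a| ≤ L * ζ) (hL : 0 ≤ L)
    (hζ : 0 ≤ ζ) : a ^ 2 ≤ B * (B + L) * min 1 ζ := by
  have ha := abs_nonneg a
  have hB : 0 ≤ B := ha.trans h1
  have h3 : |a| ≤ (B + L) * min 1 ζ := by
    rcases le_total 1 ζ with h | h
    · rw [min_eq_left h]; linarith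
    · rw [min_eq_right h]; nlinarith
  rw [← sq_abs, sq, mul_assoc]
  exact mul_le_mul h1 h3 ha hB

end LocalIntegrability

/-! ### Integrability against the singular kernel. -/

section KernelIntegrability

variable {n : ℕ} {s lam Lam : ℝ} {K : Rn n → ℝ}

theorem integrable_sq_sub_mul_kernel (hn : 2 ≤ n) (hs0 : 0 < s) (hs : s < 1) (hlam : 0 < lam)
    (hLam : 0 < Lam) (hK : KernelClassL2 n s lam Lam K) {v : Rn n → ℝ} {L : NNReal}
    (hv : LipschitzWith L v) (hvc : HasCompactSupport v) :
    Integrable (fun p : Rn n × Rn n => (v p.1 - v p.2) ^ 2 * K (p.1 - p.2)) := by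
  obtain ⟨B, hB⟩ := hvc.exists_bound_of_continuous hv.continuous
  have hvm := hv.continuous.measurable
  refine integrable_of_le_indicator hn hs0 hs (S := tsupport v) hvc.isCompact
    (C := (2 * B) * (2 * B + L) * (2 * Lam)) ?_ fun p => ?_
  · have := hK.measurable
    exact Measurable.aestronglyMeasurable (by fun_prop)
  · have hw : 0 ≤ ‖p.1 - p.2‖ ^ (-((n : ℝ) + s)) := Real.rpow_nonneg (norm_nonneg _) _
    have hmin : 0 ≤ min 1 ‖p.1 - p.2‖ := le_min zero_le_one (norm_nonneg _)
    have hB0 : 0 ≤ B := (norm_nonneg _).trans (hB 0)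
    by_cases hS : p.1 ∈ tsupport v ∨ p.2 ∈ tsupport v
    · by_cases hp : p.1 = p.2
      · simp [hp]
      · have h1 : |v p.1 - v p.2| ≤ 2 * B := by
          refine (abs_sub _ _).trans ?_
          have := hB p.1
          have := hB p.2
          simp only [Real.norm_eq_abs] at *
          linarith
        have h2 : |v p.1 - v p.2| ≤ L * ‖p.1 - p.2‖ := by
          simpa [Real.dist_eq, dist_eq_norm] using hv.dist_le_mul p.1 p.2
        have h3 := sq_le_mul_min h1 h2 L.2 (norm_nonneg _)
        have h4 := hK.abs_le hlam hs hs0 hLam (sub_ne_zero.2 hp)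
        rw [abs_mul, abs_of_nonneg (sq_nonneg _)]
        have h5 := mul_le_mul h3 h4 (abs_nonneg _) (by positivity)
        refine h5.trans ?_
        have h6 := one_le_indicator_add hS
        set X := (2 * B) * (2 * B + L) * (2 * Lam) * (min 1 ‖p.1 - p.2‖ *
          ‖p.1 - p.2‖ ^ (-((n : ℝ) + s))) with hX
        have hX0 : 0 ≤ X := by positivity
        calc _ = 1 * X := by rw [hX]; ring
          _ ≤ ((tsupport v).indicator 1 p.1 + (tsupport v).indicator 1 p.2) * X := by gcongr
          _ = _ := by rw [hX]; ring
    · push Not at hS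
      rw [image_eq_zero_of_notMem_tsupport hS.1, image_eq_zero_of_notMem_tsupport hS.2,
        Set.indicator_of_notMem hS.1, Set.indicator_of_notMem hS.2]
      simp

theorem integrable_sub_mul_mul_kernel (hn : 2 ≤ n) (hs0 : 0 < s) (hs : s < 1) (hlam : 0 < lam)
    (hLam : 0 < Lam) (hK : KernelClassL2 n s lam Lam K) {u φ : Rn n → ℝ} {Ω S : Set (Rn n)}
    (hΩ : IsOpen Ω) (hS : IsCompact S) (hSΩ : S ⊆ Ω) (hu : ContDiffOn ℝ 1 u Ω)
    (hu1 : ∀ x, |u x| ≤ 1) (hum : AEStronglyMeasurable u volume) (hφ : Continuous φ)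
    (hφS : ∀ x, x ∉ S → φ x = 0) :
    Integrable (fun p : Rn n × Rn n => (u p.1 - u p.2) * φ p.1 * K (p.1 - p.2)) := by
  obtain ⟨C, hC0, hC⟩ := exists_abs_sub_le_min hΩ hS hSΩ hu hu1
  obtain ⟨B, hB⟩ := (HasCompactSupport.intro hS hφS).exists_bound_of_continuous hφ
  have hB0 : 0 ≤ B := (norm_nonneg _).trans (hB 0)
  refine integrable_of_le_indicator hn hs0 hs (S := S) hS (C := C * B * (2 * Lam)) ?_ fun p => ?_
  · have h1 : AEStronglyMeasurable (fun p : Rn n × Rn n => u p.1) volume :=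
      AEStronglyMeasurable.comp_fst (ν := volume) hum
    have h2 : AEStronglyMeasurable (fun p : Rn n × Rn n => u p.2) volume :=
      AEStronglyMeasurable.comp_snd (μ := volume) hum
    have h3 : Measurable (fun p : Rn n × Rn n => φ p.1) := hφ.measurable.comp measurable_fst
    have h4 : Measurable (fun p : Rn n × Rn n => K (p.1 - p.2)) :=
      hK.measurable.comp (by fun_prop)
    exact ((h1.sub h2).mul h3.aestronglyMeasurable).mul h4.aestronglyMeasurable
  · have hw : 0 ≤ ‖p.1 - p.2‖ ^ (-((n : ℝ) + s)) := Real.rpow_nonneg (norm_nonneg _) _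
    by_cases hS' : p.1 ∈ S
    · have h0 := hC _ hS' p.2
      have hCm : 0 ≤ C * min 1 ‖p.1 - p.2‖ := (abs_nonneg _).trans h0
      by_cases hp : p.1 = p.2
      · simp [hp]
      · have h4 := hK.abs_le hlam hs hs0 hLam (sub_ne_zero.2 hp)
        rw [abs_mul, abs_mul]
        have h5 := mul_le_mul (mul_le_mul h0 (hB p.1) (abs_nonneg _) hCm) h4 (abs_nonneg _)
          (by positivity)
        refine h5.trans ?_
        have h6 := one_le_indicator_add (p := p) (Or.inl hS')
        set X := C * min 1 ‖p.1 - p.2‖ * B * (2 * Lam * ‖p.1 - p.2‖ ^ (-((n : ℝ) + s))) with hX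
        have hX0 : 0 ≤ X := by positivity
        calc _ = 1 * X := by rw [one_mul]
          _ ≤ (S.indicator 1 p.1 + S.indicator 1 p.2) * X := by gcongr
          _ = _ := by rw [hX]; ring
    · rw [hφS _ hS']
      simp only [mul_zero, zero_mul, abs_zero]
      have hi : ∀ x, (0 : ℝ) ≤ S.indicator 1 x :=
        fun x => Set.indicator_nonneg (fun _ _ => by simp) x
      have h1 := hi p.1
      have h2 := hi p.2
      positivity

end KernelIntegrability

/-! ### The differentiated equation and the stability inequality. -/

section Stability

variable {n : ℕ} {s lam Lam : ℝ} {K : Rn n → ℝ}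

/-- Differentiating the equation and testing against `ψ = η v`, with `v = η ∂ₑu`. -/
theorem integral_deriv2_mul_sq_eq {W : ℝ → ℝ} (hW : ContDiff ℝ 3 W) {Ω : Set (Rn n)}
    (hΩ : IsOpen Ω) {u η v ψ : Rn n → ℝ} {e : Rn n} (hη : ContDiff ℝ 1 η)
    (hc : HasCompactSupport η) (hs : tsupport η ⊆ Ω) (huΩ : ContDiffOn ℝ 2 u Ω)
    (heq : ∀ x ∈ Ω, opL K u x + deriv W (u x) = 0)
    (hv : v = fun x => η x * dirDeriv e u x) (hψ : ψ = fun x => η x * v x)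
    (hint : Integrable (fun p : Rn n × Rn n =>
      (u p.1 - u p.2) * dirDeriv e ψ p.1 * K (p.1 - p.2))) :
    ∫ x, iteratedDeriv 2 W (u x) * v x ^ 2
      = ∫ p : Rn n × Rn n, (u p.1 - u p.2) * dirDeriv e ψ p.1 * K (p.1 - p.2) := by
  have huD : ContDiffOn ℝ 1 (dirDeriv e u) Ω :=
    (huΩ.fderiv_of_isOpen (m := 1) hΩ (by norm_num)).clm_apply contDiffOn_const
  have hu1 : ContDiffOn ℝ 1 u Ω := huΩ.of_le (by norm_num)
  have hvC : ContDiff ℝ 1 v := hv ▸ hη.mul_of_tsupport_subset hΩ huD hs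
  have hψC : ContDiff ℝ 1 ψ := hψ ▸ hη.mul hvC
  have hψc : HasCompactSupport ψ := hψ ▸ hc.mul_right
  have hψs : tsupport ψ ⊆ Ω := by
    rw [hψ]; exact (tsupport_mul_subset_left (f := η) (g := v)).trans hs
  have hW1 : ContDiff ℝ 2 (deriv W) := hW.deriv'
  have hWd : Differentiable ℝ (deriv W) := hW1.differentiable two_ne_zero
  have hWu : ContDiffOn ℝ 1 (fun x => deriv W (u x)) Ω :=
    (hW1.of_le (by norm_num)).comp_contDiffOn hu1
  have hPC : ContDiff ℝ 1 (fun x => ψ x * deriv W (u x)) :=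
    hψC.mul_of_tsupport_subset hΩ hWu hψs
  have hPc : HasCompactSupport (fun x => ψ x * deriv W (u x)) := hψc.mul_right
  have hz := integral_dirDeriv_eq_zero (e := e) (hPC.differentiable one_ne_zero)
    (hPC.continuous.integrable_of_hasCompactSupport hPc)
    ((hPC.continuous_dirDeriv e).integrable_of_hasCompactSupport (hPc.fderiv_apply ℝ e))
  have hchain : ∀ x, ψ x * dirDeriv e (fun x => deriv W (u x)) x
      = iteratedDeriv 2 W (u x) * v x ^ 2 := by
    intro x
    by_cases hx : x ∈ Ω
    · have h1 : HasFDerivAt u (fderiv ℝ u x) x :=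
        ((hu1.contDiffAt (hΩ.mem_nhds hx)).differentiableAt one_ne_zero).hasFDerivAt
      have h2 := (hWd (u x)).hasDerivAt.comp_hasFDerivAt x h1
      have h3 : dirDeriv e (fun x => deriv W (u x)) x
          = deriv (deriv W) (u x) * dirDeriv e u x := by
        have h4 : fderiv ℝ (fun x => deriv W (u x)) x = _ := h2.fderiv
        simp only [dirDeriv, h4]
        simp
      rw [h3, iteratedDeriv_succ, iteratedDeriv_one, hψ, hv]
      ring
    · have h0 : η x = 0 := image_eq_zero_of_notMem_tsupport fun h => hx (hs h)
      simp only [hψ, hv, h0]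
      ring
  -- The equation holds only in `Ω`; elsewhere the factor `∂ₑψ` is zero. The derivative stays on
  -- `ψ`, so `L_K u` is never differentiated.
  have hnear : ∀ x, dirDeriv e ψ x * deriv W (u x) = - (dirDeriv e ψ x * opL K u x) := by
    intro x
    by_cases hx : x ∈ Ω
    · have := heq x hx
      rw [eq_neg_of_add_eq_zero_right this]
      ring
    · have : fderiv ℝ ψ x = 0 :=
        Function.notMem_support.1 fun h => hx (hψs (support_fderiv_subset ℝ h))
      simp [dirDeriv, this]
  have hd : ∀ x, dirDeriv e (fun x => ψ x * deriv W (u x)) x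
      = iteratedDeriv 2 W (u x) * v x ^ 2 - dirDeriv e ψ x * opL K u x := by
    intro x
    rw [dirDeriv_mul_of_tsupport_subset e (hψC.differentiable one_ne_zero) hΩ
      (hWu.differentiableOn one_ne_zero) hψs, hchain, hnear]
    ring
  have hinner : ∀ x, ∫ y, (u x - u y) * dirDeriv e ψ x * K (x - y)
      = dirDeriv e ψ x * opL K u x := by
    intro x
    rw [opL, ← integral_const_mul]
    refine integral_congr_ae (Filter.Eventually.of_forall fun y => ?_)
    beta_reduce
    ring
  have hi2 : Integrable (fun x => dirDeriv e ψ x * opL K u x) := by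
    have := hint.integral_prod_left
    simpa only [hinner] using this
  have hi1 : Integrable (fun x => iteratedDeriv 2 W (u x) * v x ^ 2) := by
    have h := ((hPC.continuous_dirDeriv e).integrable_of_hasCompactSupport
      (hPc.fderiv_apply ℝ e) (μ := volume)).add hi2
    refine h.congr (Filter.Eventually.of_forall fun x => ?_)
    simp only [Pi.add_apply, hd]
    ring
  simp only [hd] at hz
  rw [integral_sub hi1 hi2] at hz
  rw [Measure.volume_eq_prod, integral_prod _ hint]
  simp only [hinner]
  linarith

/-- Comparison of the second variation at `|v|` and at `v`. The constant is `32 = ½ · 8 · 8`: the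
factor `½` of the second variation, `8` from the energy bound and `8` from the truncated kernel. -/
theorem stability_inequality (hn : 2 ≤ n) (hs0 : 0 < s) (hs : s < 1) (hlam : 0 < lam)
    (hLam : 0 < Lam) (hK : KernelClassL2 n s lam Lam K) {W : ℝ → ℝ} (hW : ContDiff ℝ 3 W)
    {Ω : Set (Rn n)} (hΩ : IsOpen Ω) {u η v : Rn n → ℝ} {e : Rn n} (he : ‖e‖ = 1)
    (hu : IsStableSolution K W Ω u) (hu1 : ∀ x, |u x| ≤ 1) (hη : ContDiff ℝ 1 η)
    (hc : HasCompactSupport η) (hsΩ : tsupport η ⊆ Ω) {σ A c : ℝ} {χ : Rn n → ℝ}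
    (hχ : IsTruncation χ c) (hsσ : tsupport η ⊆ Metric.ball 0 σ)
    (hηA : ∀ x y, |η x - η y| ≤ A * ‖x - y‖) (hηA1 : ∀ x, |dirDeriv e η x| ≤ A)
    (hN : sobolevEnergy s σ u ≠ ⊤) (hv : v = fun x => η x * dirDeriv e u x) :
    lam * (2 * σ) ^ (-((n : ℝ) + s)) * ((∫ x, |v x|) ^ 2 - (∫ x, v x) ^ 2)
      ≤ 32 * c * Lam * A ^ 2 * (sobolevEnergy s σ u).toReal := by
  have hum := hu.aemeasurable.aestronglyMeasurable
  have huΩ := hu.contDiffOn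
  have hu1Ω : ContDiffOn ℝ 1 u Ω := huΩ.of_le (by norm_num)
  have huD : ContDiffOn ℝ 1 (dirDeriv e u) Ω :=
    (huΩ.fderiv_of_isOpen (m := 1) hΩ (by norm_num)).clm_apply contDiffOn_const
  have hvC : ContDiff ℝ 1 v := hv ▸ hη.mul_of_tsupport_subset hΩ huD hsΩ
  have hvc : HasCompactSupport v := hv ▸ hc.mul_right
  have hv0 : ∀ x, x ∉ tsupport η → v x = 0 := fun x hx => by
    simp [hv, image_eq_zero_of_notMem_tsupport hx]
  -- `ψ = η² ∂ₑu` tests the differentiated equation, since `ψ ∂ₑu = v²`.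
  obtain ⟨ψ, hψ⟩ : ∃ ψ : Rn n → ℝ, ψ = fun x => η x * v x := ⟨_, rfl⟩
  have hψC : ContDiff ℝ 1 ψ := hψ ▸ hη.mul hvC
  have hψs : tsupport ψ ⊆ tsupport η := by
    rw [hψ]; exact tsupport_mul_subset_left (f := η) (g := v)
  have hφ0 : ∀ x, x ∉ tsupport η → dirDeriv e ψ x = 0 := fun x hx => by
    have : fderiv ℝ ψ x = 0 :=
      Function.notMem_support.1 fun h => hx (hψs (support_fderiv_subset ℝ h))
    simp [dirDeriv, this]
  obtain ⟨L, hL⟩ := hvC.lipschitzWith_of_hasCompactSupport hvc one_ne_zero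
  have hLa : LipschitzWith L fun x => |v x| := by
    have := lipschitzWith_one_norm.comp hL
    rw [one_mul] at this
    exact this
  have hvac : HasCompactSupport fun x => |v x| := hvc.norm
  have iv := integrable_sq_sub_mul_kernel hn hs0 hs hlam hLam hK hL hvc
  have ia := integrable_sq_sub_mul_kernel hn hs0 hs hlam hLam hK hLa hvac
  have iψ := integrable_sub_mul_mul_kernel hn hs0 hs hlam hLam hK hΩ hc.isCompact hsΩ hu1Ω hu1
    hum (hψC.continuous_dirDeriv e) hφ0
  have hWv := integral_deriv2_mul_sq_eq hW hΩ hη hc hsΩ huΩ hu.equation hv hψ iψ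
  -- The modulus `|v|` is only Lipschitz, which the class of test functions allows.
  have hst := hu.stable (fun x => |v x|) ⟨L, hLa⟩ hvac fun x hx => by
    simp [hv0 x fun h => hx (hsΩ h)]
  simp only [sq_abs] at hst
  rw [hWv] at hst
  -- the quadratic form at `|v|` and at `v`
  have iG : Integrable (fun p : Rn n × Rn n =>
      (|v p.1| * |v p.2| - v p.1 * v p.2) * K (p.1 - p.2)) := by
    refine ((iv.const_mul (1 / 2)).sub (ia.const_mul (1 / 2))).congr
      (Filter.Eventually.of_forall fun p => ?_)
    simp only [Pi.sub_apply]
    rw [show (|v p.1| - |v p.2|) ^ 2 = |v p.1| ^ 2 + |v p.2| ^ 2 - 2 * (|v p.1| * |v p.2|) by ring,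
      sq_abs, sq_abs]
    ring
  have iF : Integrable (fun p : Rn n × Rn n =>
      (1 / 2 * (v p.1 - v p.2) ^ 2 + (u p.1 - u p.2) * dirDeriv e ψ p.1) * K (p.1 - p.2)) := by
    refine ((iv.const_mul (1 / 2)).add iψ).congr (Filter.Eventually.of_forall fun p => ?_)
    simp only [Pi.add_apply]
    ring
  -- `½(v(x) - v(y))²` equals `½(|v(x)| - |v(y)|)²` plus `|v(x)||v(y)| - v(x)v(y)`; stability makes
  -- the former, together with the `ψ` term, nonnegative.
  have hGF : ∫ p : Rn n × Rn n, (|v p.1| * |v p.2| - v p.1 * v p.2) * K (p.1 - p.2)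
      ≤ ∫ p : Rn n × Rn n,
        (1 / 2 * (v p.1 - v p.2) ^ 2 + (u p.1 - u p.2) * dirDeriv e ψ p.1) * K (p.1 - p.2) := by
    have h := (((IntegrableWith.of_integrable ia).smul (1 / 2)).add
      (IntegrableWith.of_integrable iψ)).add (IntegrableWith.of_integrable iG) |>.congr
      (g := fun p : Rn n × Rn n =>
        (1 / 2 * (v p.1 - v p.2) ^ 2 + (u p.1 - u p.2) * dirDeriv e ψ p.1) * K (p.1 - p.2))
      (fun p => by
        rw [show (|v p.1| - |v p.2|) ^ 2
          = |v p.1| ^ 2 + |v p.2| ^ 2 - 2 * (|v p.1| * |v p.2|) by ring, sq_abs, sq_abs]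
        ring) rfl
    rw [h.2]
    linarith
  -- removal of the singularity of the kernel
  have hF : ∫ p : Rn n × Rn n,
      (1 / 2 * (v p.1 - v p.2) ^ 2 + (u p.1 - u p.2) * dirDeriv e ψ p.1) * K (p.1 - p.2)
        ≤ 32 * c * Lam * A ^ 2 * (sobolevEnergy s σ u).toReal := by
    have hlim : Filter.Tendsto (fun m : ℕ => ∫ p : Rn n × Rn n,
        (1 / 2 * (v p.1 - v p.2) ^ 2 + (u p.1 - u p.2) * dirDeriv e ψ p.1)
          * (χ (((m : ℝ) + 1) • (p.1 - p.2)) * K (p.1 - p.2))) Filter.atTop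
        (nhds (∫ p : Rn n × Rn n,
          (1 / 2 * (v p.1 - v p.2) ^ 2 + (u p.1 - u p.2) * dirDeriv e ψ p.1) * K (p.1 - p.2))) := by
      refine tendsto_integral_of_dominated_convergence _ (fun m => ?_) iF.norm (fun m => ?_) ?_
      · have h1 : Measurable fun p : Rn n × Rn n => χ (((m : ℝ) + 1) • (p.1 - p.2)) :=
          hχ.contDiff.continuous.measurable.comp (by fun_prop)
        refine (iF.aestronglyMeasurable.mul h1.aestronglyMeasurable).congr
          (Filter.Eventually.of_forall fun p => ?_)
        simp only [Pi.mul_apply]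
        ring
      · refine Filter.Eventually.of_forall fun p => ?_
        rw [mul_left_comm, norm_mul]
        exact mul_le_of_le_one_left (norm_nonneg _) (hχ.abs_le_one _)
      · refine Filter.Eventually.of_forall fun p => ?_
        by_cases hp : p.1 = p.2
        · simp [hp]
        · have hz : 0 < ‖p.1 - p.2‖ := norm_pos_iff.2 (sub_ne_zero.2 hp)
          refine tendsto_const_nhds.congr' ?_
          obtain ⟨N, hNn⟩ := exists_nat_ge (2 / ‖p.1 - p.2‖)
          filter_upwards [Filter.eventually_ge_atTop N] with m hm
          rw [hχ.one_far, one_mul]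
          have hm' : (N : ℝ) ≤ m := by exact_mod_cast hm
          rw [norm_smul, Real.norm_of_nonneg (by positivity)]
          calc 2 = 2 / ‖p.1 - p.2‖ * ‖p.1 - p.2‖ := by field_simp
            _ ≤ ((m : ℝ) + 1) * ‖p.1 - p.2‖ := by gcongr; linarith
    refine le_of_tendsto hlim (Filter.Eventually.of_forall fun m => ?_)
    -- The scale is `m + 1` rather than `m` so that it is positive at `m = 0`.
    have ht : (0 : ℝ) < (m : ℝ) + 1 := by positivity
    have hsk := smoothKernel_truncation hn hχ hK hlam hLam hs0 hs ht he
    have hbu : BddMeas u := ⟨hum, 1, hu1⟩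
    rw [integral_secondVariation_eq hsk hη hc hΩ hsΩ hbu huΩ hv hψ]
    have hcpos : 0 ≤ 8 * c * Lam := by have := hχ.one_le; positivity
    have := integral_sq_mul_cutoffKernel_le (k := fun z => χ (((m : ℝ) + 1) • z) * K z) hcpos
      hηA hηA1 (fun z hz => truncation_bounds hχ hK hlam hLam hs0 hs ht he hz) hsσ hum hN
    linarith
  -- lower bound for the kernel
  have hvi : Integrable v := hvC.continuous.integrable_of_hasCompactSupport hvc
  have hprod : IntegrableWith volume (fun p : Rn n × Rn n =>
      lam * (2 * σ) ^ (-((n : ℝ) + s)) * (|v p.1| * |v p.2| - v p.1 * v p.2))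
      (lam * (2 * σ) ^ (-((n : ℝ) + s)) * ((∫ x, |v x|) ^ 2 - (∫ x, v x) ^ 2)) := by
    have h1 : IntegrableWith volume (fun p : Rn n × Rn n => |v p.1| * |v p.2|)
        ((∫ x, |v x|) ^ 2) :=
      ⟨hvi.abs.mul_prod hvi.abs, by
        rw [Measure.volume_eq_prod, integral_prod_mul (fun x => |v x|) fun x => |v x|, sq]⟩
    have h2 : IntegrableWith volume (fun p : Rn n × Rn n => v p.1 * v p.2) ((∫ x, v x) ^ 2) :=
      ⟨hvi.mul_prod hvi, by rw [Measure.volume_eq_prod, integral_prod_mul v v, sq]⟩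
    exact (h1.sub h2).smul _
  rw [← hprod.2]
  refine (integral_mono hprod.1 iG fun p => ?_).trans (hGF.trans hF)
  beta_reduce
  by_cases h1 : p.1 ∈ tsupport η
  · by_cases h2 : p.2 ∈ tsupport η
    · by_cases hp : p.1 = p.2
      · simp [hp]
      · have hz : 0 < ‖p.1 - p.2‖ := norm_pos_iff.2 (sub_ne_zero.2 hp)
        rw [mul_comm]
        have hge : 0 ≤ |v p.1| * |v p.2| - v p.1 * v p.2 := by
          rw [← abs_mul]; linarith [le_abs_self (v p.1 * v p.2)]
        refine mul_le_mul_of_nonneg_left ?_ hge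
        refine le_trans ?_ (hK.lower _ (sub_ne_zero.2 hp))
        have hlt : ‖p.1 - p.2‖ ≤ 2 * σ := by
          have h3 : ‖p.1‖ < σ := by simpa using hsσ h1
          have h4 : ‖p.2‖ < σ := by simpa using hsσ h2
          linarith [norm_sub_le p.1 p.2]
        have hpw : (2 * σ) ^ (-((n : ℝ) + s)) ≤ ‖p.1 - p.2‖ ^ (-((n : ℝ) + s)) :=
          Real.rpow_le_rpow_of_nonpos hz hlt (by have : (0 : ℝ) ≤ n := n.cast_nonneg
                                                 linarith)
        rw [Real.rpow_neg hz.le] at hpw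
        rw [div_eq_mul_inv]
        have h0 : 0 ≤ (2 * σ) ^ (-((n : ℝ) + s)) := Real.rpow_nonneg (by linarith) _
        have : lam ≤ (2 - s) * lam := by nlinarith
        exact mul_le_mul this hpw h0 (by nlinarith)
    · simp [hv0 _ h2]
  · simp [hv0 _ h1]

end Stability

/-! ### Radial cutoffs with explicit gradient bound. -/

section Cutoff

theorem exists_smoothTransition_deriv_le :
    ∃ M : ℝ, 0 < M ∧ ∀ t, |deriv Real.smoothTransition t| ≤ M := by
  have hc : Continuous (deriv Real.smoothTransition) :=
    (Real.smoothTransition.contDiff (n := 1)).continuous_deriv le_rfl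
  obtain ⟨M, hM⟩ := (isCompact_Icc (a := (0 : ℝ)) (b := 1)).exists_bound_of_continuousOn
    hc.continuousOn
  refine ⟨|M| + 1, by positivity, fun t => ?_⟩
  have hz : ∀ t c, Real.smoothTransition =ᶠ[nhds t] (fun _ => c) →
      |deriv Real.smoothTransition t| ≤ |M| + 1 := fun t c h => by
    rw [h.deriv_eq, deriv_const, abs_zero]; positivity
  by_cases h : t ∈ Set.Icc (0 : ℝ) 1
  · exact (hM t h).trans ((le_abs_self M).trans (by linarith))
  · rcases lt_or_ge t 0 with h0 | h0
    · refine hz t 0 ?_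
      filter_upwards [Iio_mem_nhds h0] with y hy
      exact Real.smoothTransition.zero_of_nonpos (le_of_lt hy)
    · have h1 : 1 < t := by
        by_contra h1
        exact h ⟨h0, not_lt.1 h1⟩
      refine hz t 1 ?_
      filter_upwards [Ioi_mem_nhds h1] with y hy
      exact Real.smoothTransition.one_of_one_le (le_of_lt hy)

/-- The transition is applied to an affine function of `‖x‖²`, smooth at the origin too. The
gradient bound comes from `2τ/(τ² - ρ²) ≤ 2/(τ - ρ)`. -/
theorem exists_cutoff {n : ℕ} {M : ℝ} (hM : ∀ t, |deriv Real.smoothTransition t| ≤ M)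
    {ρ τ : ℝ} (hρ : 0 < ρ) (hρτ : ρ < τ) :
    ∃ η : Rn n → ℝ, ContDiff ℝ 1 η ∧ tsupport η ⊆ Metric.closedBall 0 τ ∧
      (∀ x ∈ Metric.ball (0 : Rn n) ρ, η x = 1) ∧
      (∀ x y, |η x - η y| ≤ 2 * M / (τ - ρ) * ‖x - y‖) ∧
      ∀ e : Rn n, ‖e‖ = 1 → ∀ x, |dirDeriv e η x| ≤ 2 * M / (τ - ρ) := by
  have hq : 0 < τ ^ 2 - ρ ^ 2 := by nlinarith
  have hd : 0 < τ - ρ := by linarith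
  have hM0 : 0 ≤ M := (abs_nonneg _).trans (hM 0)
  set g : Rn n → ℝ := fun x => (τ ^ 2 - ‖x‖ ^ 2) / (τ ^ 2 - ρ ^ 2) with hg
  have hgC : ContDiff ℝ 1 g := (contDiff_const.sub (contDiff_norm_sq ℝ)).div_const _
  have hηC : ContDiff ℝ 1 fun x => Real.smoothTransition (g x) :=
    Real.smoothTransition.contDiff.comp hgC
  have hder : ∀ x, ‖fderiv ℝ (fun x => Real.smoothTransition (g x)) x‖ ≤ 2 * M / (τ - ρ) := by
    intro x
    rcases lt_or_ge τ ‖x‖ with hx | hx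
    · have hev : (fun x => Real.smoothTransition (g x)) =ᶠ[nhds x] fun _ => 0 := by
        filter_upwards [(isOpen_lt continuous_const continuous_norm).mem_nhds hx] with y hy
        refine Real.smoothTransition.zero_of_nonpos
          (div_nonpos_of_nonpos_of_nonneg ?_ hq.le)
        have hy' : τ < ‖y‖ := hy
        nlinarith
      rw [hev.fderiv_eq, fderiv_fun_const]
      simp only [Pi.zero_apply, norm_zero]
      positivity
    · have hgd : HasFDerivAt g ((τ ^ 2 - ρ ^ 2)⁻¹ • -((2 : ℕ) • (innerSL ℝ x : Rn n →L[ℝ] ℝ))) x := by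
        have h1 := ((hasStrictFDerivAt_norm_sq x).hasFDerivAt.const_sub (τ ^ 2)).const_mul
          (τ ^ 2 - ρ ^ 2)⁻¹
        refine h1.congr_of_eventuallyEq (Filter.Eventually.of_forall fun y => ?_)
        simp only [hg, div_eq_inv_mul]
      have hφd : HasDerivAt Real.smoothTransition (deriv Real.smoothTransition (g x)) (g x) :=
        ((Real.smoothTransition.contDiff (n := 1)).differentiable one_ne_zero _).hasDerivAt
      have h := hφd.comp_hasFDerivAt x hgd
      have h' : fderiv ℝ (fun x => Real.smoothTransition (g x)) x = _ := h.fderiv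
      rw [h', norm_smul, norm_smul, norm_neg, Real.norm_eq_abs,
        Real.norm_of_nonneg (inv_nonneg.2 hq.le)]
      have h2 : ‖(2 : ℕ) • (innerSL ℝ x : Rn n →L[ℝ] ℝ)‖ ≤ 2 * τ := by
        refine (norm_nsmul_le).trans ?_
        rw [innerSL_apply_norm]
        push_cast
        linarith
      calc |deriv Real.smoothTransition (g x)| * ((τ ^ 2 - ρ ^ 2)⁻¹ * ‖(2 : ℕ) • (innerSL ℝ x : Rn n →L[ℝ] ℝ)‖)
          ≤ M * ((τ ^ 2 - ρ ^ 2)⁻¹ * (2 * τ)) := by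
            gcongr
            exact hM _
        _ ≤ 2 * M / (τ - ρ) := by
            have : (τ ^ 2 - ρ ^ 2)⁻¹ * (2 * τ) ≤ 2 / (τ - ρ) := by
              rw [inv_mul_le_iff₀ hq, ← mul_div_assoc, le_div_iff₀ hd]
              nlinarith
            calc _ ≤ M * (2 / (τ - ρ)) := by gcongr
              _ = _ := by ring
  refine ⟨fun x => Real.smoothTransition (g x), hηC, ?_, fun x hx => ?_, fun x y => ?_,
    fun e he x => ?_⟩
  · refine closure_minimal (fun x hx => ?_) Metric.isClosed_closedBall
    by_contra h
    refine hx (Real.smoothTransition.zero_of_nonpos (div_nonpos_of_nonpos_of_nonneg ?_ hq.le))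
    have : τ < ‖x‖ := by simpa using h
    nlinarith
  · refine Real.smoothTransition.one_of_one_le ((one_le_div hq).2 ?_)
    have : ‖x‖ < ρ := by simpa using hx
    nlinarith [norm_nonneg x]
  · exact convex_univ.norm_image_sub_le_of_norm_fderiv_le (𝕜 := ℝ)
      (fun z _ => hηC.differentiable one_ne_zero z) (fun z _ => hder z) (Set.mem_univ y)
      (Set.mem_univ x)
  · have := (fderiv ℝ (fun x => Real.smoothTransition (g x)) x).le_opNorm e
    rw [he, mul_one] at this
    exact this.trans (hder x)

end Cutoff

/-! ### The estimate for one directional derivative. -/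

section Directional

variable {n : ℕ} {s lam Lam : ℝ} {K : Rn n → ℝ}

theorem integrableOn_norm_fderiv {u : Rn n → ℝ} {Ω : Set (Rn n)} {r r' : ℝ} (hΩ : IsOpen Ω)
    (hu : ContDiffOn ℝ 1 u Ω) (hrr : r < r') (hB : Metric.ball (0 : Rn n) r' ⊆ Ω) :
    IntegrableOn (fun x => ‖fderiv ℝ u x‖) (Metric.ball (0 : Rn n) r) := by
  have h : ContinuousOn (fun x => ‖fderiv ℝ u x‖) (Metric.closedBall (0 : Rn n) r) :=
    ((hu.continuousOn_fderiv_of_isOpen hΩ le_rfl).mono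
      ((Metric.closedBall_subset_ball hrr).trans hB)).norm
  exact (h.integrableOn_compact (isCompact_closedBall _ _)).mono_set Metric.ball_subset_closedBall

/-- The width `3d` is spent in three layers: the cutoff decays up to `ρ + d`, the energy is taken
over the ball of radius `ρ + 2d`, and the gradient over that of radius `ρ + 3d`, leaving distance
`d` for the tail. -/
theorem directional_estimate (hn : 2 ≤ n) (hs0 : 0 < s) (hs : s < 1) (hlam : 0 < lam)
    (hLam : 0 < Lam) (hK : KernelClassL2 n s lam Lam K) {W : ℝ → ℝ} (hW : ContDiff ℝ 3 W)
    {R : ℝ} {u : Rn n → ℝ} {e : Rn n} (he : ‖e‖ = 1)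
    (hu : IsStableSolution K W (Metric.ball (0 : Rn n) R) u) (hu1 : ∀ x, |u x| ≤ 1)
    {c M : ℝ} {χ : Rn n → ℝ} (hχ : IsTruncation χ c)
    (hM : ∀ t, |deriv Real.smoothTransition t| ≤ M) {ρ d : ℝ} (hρ : 0 < ρ) (hd : 0 < d)
    (hR : ρ + 3 * d < R) :
    lam * (2 * (ρ + 2 * d)) ^ (-((n : ℝ) + s)) *
        ((∫ x in Metric.ball (0 : Rn n) ρ, |dirDeriv e u x|) ^ 2
          - (2 * M / d * volume.real (Metric.ball (0 : Rn n) (ρ + 2 * d))) ^ 2)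
      ≤ 32 * c * Lam * (2 * M / d) ^ 2 *
        (2 * (sphereArea n * ((2 * (ρ + 3 * d)) ^ (1 - s) / (1 - s)) *
            ∫ x in Metric.ball (0 : Rn n) (ρ + 3 * d), ‖fderiv ℝ u x‖)
          + 4 * (sphereArea n * (d ^ (-s) / s)) *
            volume.real (Metric.ball (0 : Rn n) (ρ + 2 * d))) := by
  have hΩ : IsOpen (Metric.ball (0 : Rn n) R) := Metric.isOpen_ball
  have hu1Ω : ContDiffOn ℝ 1 u (Metric.ball (0 : Rn n) R) := hu.contDiffOn.of_le (by norm_num)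
  have hum := hu.aemeasurable.aestronglyMeasurable
  obtain ⟨η, hηC, hηs, hη1, hηA, hηA1⟩ := exists_cutoff (n := n) hM hρ
    (show ρ < ρ + d by linarith)
  rw [add_sub_cancel_left] at hηA hηA1
  have hc : HasCompactSupport η :=
    (isCompact_closedBall (0 : Rn n) (ρ + d)).of_isClosed_subset (isClosed_tsupport _) hηs
  have hsσ : tsupport η ⊆ Metric.ball 0 (ρ + 2 * d) :=
    hηs.trans (Metric.closedBall_subset_ball (by linarith))
  have hsΩ : tsupport η ⊆ Metric.ball 0 R := hsσ.trans (Metric.ball_subset_ball (by linarith))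
  have hM0 : 0 ≤ M := (abs_nonneg _).trans (hM 0)
  have hA0 : 0 ≤ 2 * M / d := by positivity
  have hI := integrableOn_norm_fderiv (r := ρ + 3 * d) hΩ hu1Ω hR subset_rfl
  have hN := sobolevEnergy_le hn hs0 hs (σ := ρ + 2 * d) (r := ρ + 3 * d) (by linarith)
    (by linarith) hΩ hu1Ω (Metric.ball_subset_ball hR.le) hum hu1
  have hIe : ∫⁻ x in Metric.ball (0 : Rn n) (ρ + 3 * d), ‖fderiv ℝ u x‖ₑ
      = ENNReal.ofReal (∫ x in Metric.ball (0 : Rn n) (ρ + 3 * d), ‖fderiv ℝ u x‖) := by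
    rw [ofReal_integral_eq_lintegral_ofReal hI
      (Filter.Eventually.of_forall fun x => norm_nonneg _)]
    simp only [ofReal_norm]
  have hV : volume (Metric.ball (0 : Rn n) (ρ + 2 * d)) ≠ ⊤ := measure_ball_lt_top.ne
  have hS := sphereArea_nonneg n
  have h1s : 0 < 1 - s := by linarith
  have hI0 : 0 ≤ ∫ x in Metric.ball (0 : Rn n) (ρ + 3 * d), ‖fderiv ℝ u x‖ :=
    integral_nonneg fun x => norm_nonneg _
  have hc1 : 0 ≤ sphereArea n * ((2 * (ρ + 3 * d)) ^ (1 - s) / (1 - s)) := by positivity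
  have hc2 : 0 ≤ sphereArea n * (d ^ (-s) / s) := by positivity
  rw [hIe, show ρ + 3 * d - (ρ + 2 * d) = d by ring, ← ENNReal.ofReal_mul hc1,
    ← ENNReal.ofReal_toReal hV] at hN
  have h2 : ∀ X, 2 * ENNReal.ofReal X = ENNReal.ofReal (2 * X) := fun X => by
    rw [ENNReal.ofReal_mul zero_le_two, ENNReal.ofReal_ofNat]
  have h4 : ∀ X, 4 * ENNReal.ofReal X = ENNReal.ofReal (4 * X) := fun X => by
    rw [ENNReal.ofReal_mul zero_le_four, ENNReal.ofReal_ofNat]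
  rw [h2, h4, ← ENNReal.ofReal_mul (by positivity),
    ← ENNReal.ofReal_add (by positivity) (by positivity)] at hN
  have hNtop : sobolevEnergy s (ρ + 2 * d) u ≠ ⊤ := (hN.trans_lt ENNReal.ofReal_lt_top).ne
  have hNr := ENNReal.toReal_le_of_le_ofReal (by positivity) hN
  have key := stability_inequality hn hs0 hs hlam hLam hK hW hΩ he hu hu1 hηC hc hsΩ hχ hsσ hηA
    (hηA1 e he) hNtop (v := fun x => η x * dirDeriv e u x) rfl
  have hcpos : 0 ≤ c := zero_le_one.trans hχ.one_le
  have huD : ContDiffOn ℝ 1 (dirDeriv e u) (Metric.ball (0 : Rn n) R) :=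
    (hu.contDiffOn.fderiv_of_isOpen (m := 1) hΩ (by norm_num)).clm_apply contDiffOn_const
  have hvC : ContDiff ℝ 1 (fun x => η x * dirDeriv e u x) :=
    hηC.mul_of_tsupport_subset hΩ huD hsΩ
  have hvc : HasCompactSupport (fun x => η x * dirDeriv e u x) := hc.mul_right
  have hvi := hvC.continuous.integrable_of_hasCompactSupport (μ := volume) hvc
  -- lower bound for `∫ |v|`
  have hJ : ∫ x in Metric.ball (0 : Rn n) ρ, |dirDeriv e u x|
      ≤ ∫ x, |η x * dirDeriv e u x| := by
    have h1 : ∫ x in Metric.ball (0 : Rn n) ρ, |dirDeriv e u x|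
        = ∫ x in Metric.ball (0 : Rn n) ρ, |η x * dirDeriv e u x| :=
      setIntegral_congr_fun measurableSet_ball fun x hx => by simp only [hη1 x hx, one_mul]
    rw [h1]
    exact setIntegral_le_integral hvi.abs (Filter.Eventually.of_forall fun x => abs_nonneg _)
  -- upper bound for `|∫ v|`
  have hv : |∫ x, η x * dirDeriv e u x|
      ≤ 2 * M / d * volume.real (Metric.ball (0 : Rn n) (ρ + 2 * d)) := by
    have hpC : ContDiff ℝ 1 (fun x => η x * u x) := hηC.mul_of_tsupport_subset hΩ hu1Ω hsΩ
    have hpc : HasCompactSupport (fun x => η x * u x) := hc.mul_right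
    have hz := integral_dirDeriv_eq_zero (e := e) (hpC.differentiable one_ne_zero)
      (hpC.continuous.integrable_of_hasCompactSupport hpc)
      ((hpC.continuous_dirDeriv e).integrable_of_hasCompactSupport (hpc.fderiv_apply ℝ e))
    have hq : Integrable (fun x => dirDeriv e η x * u x) :=
      (⟨hum, 1, hu1⟩ : BddMeas u).integrable_mul
        ((hηC.continuous_dirDeriv e).integrable_of_hasCompactSupport (hc.fderiv_apply ℝ e))
    simp only [dirDeriv_mul_of_tsupport_subset e (hηC.differentiable one_ne_zero) hΩ
      (hu1Ω.differentiableOn one_ne_zero) hsΩ] at hz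
    rw [integral_add hvi hq] at hz
    rw [eq_neg_of_add_eq_zero_left hz, abs_neg]
    have hsupp : ∫ x in Metric.ball (0 : Rn n) (ρ + 2 * d), dirDeriv e η x * u x
        = ∫ x, dirDeriv e η x * u x := by
      refine setIntegral_eq_integral_of_forall_compl_eq_zero fun x hx => ?_
      have : fderiv ℝ η x = 0 :=
        Function.notMem_support.1 fun h => hx (hsσ (support_fderiv_subset ℝ h))
      simp [dirDeriv, this]
    rw [← hsupp]
    rw [← Real.norm_eq_abs]
    refine norm_setIntegral_le_of_norm_le_const (μ := volume) measure_ball_lt_top fun x _ => ?_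
    rw [norm_mul]
    calc ‖dirDeriv e η x‖ * ‖u x‖ ≤ 2 * M / d * 1 :=
          mul_le_mul (hηA1 e he x) (hu1 x) (norm_nonneg _) hA0
      _ = _ := mul_one _
  have hJ0 : 0 ≤ ∫ x in Metric.ball (0 : Rn n) ρ, |dirDeriv e u x| :=
    integral_nonneg fun x => abs_nonneg _
  have hw : 0 ≤ lam * (2 * (ρ + 2 * d)) ^ (-((n : ℝ) + s)) := by positivity
  have hJ2 := pow_le_pow_left₀ hJ0 hJ 2
  have hv2 := pow_le_pow_left₀ (abs_nonneg _) hv 2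
  rw [sq_abs] at hv2
  refine (mul_le_mul_of_nonneg_left (by linarith) hw).trans (key.trans ?_)
  exact mul_le_mul_of_nonneg_left hNr (by positivity)

end Directional

/-! ### Numerical inequalities: absorption and scaling. -/

section RealEstimates

/-- Absorption by iteration with the weight `(3/2 - x)³`, matched to the cubic singularity. The a
priori bound `F` starts the induction and is multiplied by `(7/10)^k`, so it does not survive in the
limit. -/
theorem le_of_iterated_bound {g : ℝ → ℝ} {F B : ℝ} (hB : 0 ≤ B)
    (hF : ∀ x, 1 ≤ x → x ≤ 3 / 2 → g x ≤ F)
    (h : ∀ x y, 1 ≤ x → x < y → y ≤ 3 / 2 → g x ≤ 1 / 2 * g y + B / (y - x) ^ 3) :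
    g 1 ≤ 32000 * B := by
  have key : ∀ k : ℕ, ∀ x, 1 ≤ x → x < 3 / 2 →
      (3 / 2 - x) ^ 3 * g x ≤ (7 / 10) ^ k * |F| + 4000 * B := by
    intro k
    induction k with
    | zero =>
      intro x h1 h2
      have hw : 0 < 3 / 2 - x := by linarith
      have hw1 : (3 / 2 - x) ^ 3 ≤ 1 := pow_le_one₀ hw.le (by linarith)
      have hg : g x ≤ |F| := (hF x h1 h2.le).trans (le_abs_self F)
      have h3 : (3 / 2 - x) ^ 3 * g x ≤ (3 / 2 - x) ^ 3 * |F| := by gcongr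
      have h4 : (3 / 2 - x) ^ 3 * |F| ≤ 1 * |F| := by gcongr
      rw [pow_zero]
      linarith
    | succ k ih =>
      intro x h1 h2
      set w := 3 / 2 - x with hwdef
      -- Moving a tenth of the way to `3/2` multiplies the weight by `(9/10)³`, and `½ (10/9)³ <
      -- 7/10`; the constant closes because `7/10 · 4000 + 1000 ≤ 4000`. At `x = 1` the weight is
      -- `1/8`, whence `32000`.
      have hw : 0 < w := by linarith
      have hy := ih (x + w / 10) (by linarith) (by linarith)
      have hg := h x (x + w / 10) h1 (by linarith) (by linarith)
      rw [show 3 / 2 - (x + w / 10) = 9 / 10 * w by rw [hwdef]; ring] at hy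
      rw [show x + w / 10 - x = w / 10 by ring] at hg
      have h3 : w ^ 3 * (B / (w / 10) ^ 3) = 1000 * B := by field_simp; ring
      have h4 : w ^ 3 * g x ≤ w ^ 3 * (1 / 2 * g (x + w / 10) + B / (w / 10) ^ 3) := by gcongr
      have h5 : 0 ≤ (7 / 10 : ℝ) ^ k * |F| := by positivity
      rw [mul_add, h3] at h4
      rw [mul_pow] at hy
      rw [pow_succ (7 / 10 : ℝ) k]
      linarith
  have hlim : Filter.Tendsto (fun k : ℕ => (7 / 10 : ℝ) ^ k * |F| + 4000 * B) Filter.atTop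
      (nhds (0 * |F| + 4000 * B)) :=
    ((tendsto_pow_atTop_nhds_zero_of_lt_one (by norm_num) (by norm_num)).mul_const _).add_const _
  have := ge_of_tendsto' hlim fun k => key k 1 le_rfl (by norm_num)
  norm_num at this
  linarith

/-- Scaling: `R^{n+s}` from the kernel, `d^{-2}` from the cutoff and `R^{1-s}` from the energy
combine to `R^{n-1} (R/d)²`. The tail costs one more factor `R/d`, hence the cube. -/
theorem quadratic_bound {n : ℕ} (hn : 1 ≤ n) {s s₀ R d σ r lam c Lam M S ω V J I : ℝ}
    (hs₀ : 0 < s₀) (hss : s₀ < s) (hs : s < 1) (hR : 0 < R) (hd : 0 < d) (hdR : d ≤ R)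
    (hσ : 0 < σ) (hσR : σ ≤ 2 * R) (hr : 0 < r) (hrR : r ≤ 2 * R) (hlam : 0 < lam)
    (hc : 0 ≤ c) (hLam : 0 ≤ Lam) (hM : 0 ≤ M) (hS : 0 ≤ S) (hω : 0 ≤ ω) (hV0 : 0 ≤ V)
    (hV : V ≤ 2 ^ n * R ^ n * ω) (hI : 0 ≤ I)
    (h : lam * (2 * σ) ^ (-((n : ℝ) + s)) * (J ^ 2 - (2 * M / d * V) ^ 2)
      ≤ 32 * c * Lam * (2 * M / d) ^ 2 *
        (2 * (S * ((2 * r) ^ (1 - s) / (1 - s)) * I) + 4 * (S * (d ^ (-s) / s)) * V)) :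
    J ^ 2 ≤ ((2 ^ (n + 1) * M * ω) ^ 2
        + 32 * c * Lam / lam * 4 ^ (n + 2) * M ^ 2 * (8 * S + 4 * 2 ^ n * S * ω / s₀))
      * ((R / d) ^ 3 / (1 - s)) * R ^ (n - 1) * (I + R ^ (n - 1)) := by
  have hs0 : 0 < s := hs₀.trans hss
  have h1s : 0 < 1 - s := by linarith
  set P := R ^ (n - 1) with hP
  have hP0 : 0 < P := by positivity
  have hRn : R ^ n = R * P := by rw [hP, ← pow_succ', Nat.sub_add_cancel hn]
  set q := R / d with hq
  have hq1 : 1 ≤ q := (one_le_div hd).2 hdR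
  set X := R ^ (1 - s) with hX
  have hX0 : 0 < X := Real.rpow_pos_of_pos hR _
  set Y := R ^ ((n : ℝ) + s) with hY
  have hY0 : 0 < Y := Real.rpow_pos_of_pos hR _
  have hXY : Y * X = R ^ 2 * P := by
    rw [hX, hY, ← Real.rpow_add hR, show (n : ℝ) + s + (1 - s) = ((n + 1 : ℕ) : ℝ) by
      push_cast; ring, Real.rpow_natCast, pow_succ, hRn]
    ring
  have hXR : R ^ (-s) * R = X := by
    rw [hX, show (1 - s : ℝ) = -s + 1 by ring, Real.rpow_add hR, Real.rpow_one]
  have hone : 1 ≤ 1 / (1 - s) := (one_le_div h1s).2 (by linarith)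
  have t1 : (2 * σ) ^ ((n : ℝ) + s) ≤ 4 ^ (n + 1) * Y := by
    calc (2 * σ) ^ ((n : ℝ) + s) ≤ (4 * R) ^ ((n : ℝ) + s) :=
          Real.rpow_le_rpow (by positivity) (by linarith) (by positivity)
      _ = 4 ^ ((n : ℝ) + s) * Y := Real.mul_rpow (by norm_num) hR.le
      _ ≤ 4 ^ (n + 1) * Y := by
          gcongr
          rw [← Real.rpow_natCast]
          exact Real.rpow_le_rpow_of_exponent_le (by norm_num) (by push_cast; linarith)
  have t2 : (2 * r) ^ (1 - s) ≤ 4 * X := by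
    calc (2 * r) ^ (1 - s) ≤ (4 * R) ^ (1 - s) :=
          Real.rpow_le_rpow (by positivity) (by linarith) h1s.le
      _ = 4 ^ (1 - s) * X := Real.mul_rpow (by norm_num) hR.le
      _ ≤ 4 * X := by
          gcongr
          calc (4 : ℝ) ^ (1 - s) ≤ 4 ^ (1 : ℝ) :=
                Real.rpow_le_rpow_of_exponent_le (by norm_num) (by linarith)
            _ = 4 := Real.rpow_one 4
  -- Replacing `q^s` by `q`, as `q ≥ 1` and `s < 1`, keeps the exponent of `R/d` independent of `s`.
  have t3 : d ^ (-s) ≤ R ^ (-s) * q := by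
    have hqs : q ^ s ≤ q := by
      calc q ^ s ≤ q ^ (1 : ℝ) := Real.rpow_le_rpow_of_exponent_le hq1 hs.le
        _ = q := Real.rpow_one q
    have : d ^ (-s) = R ^ (-s) * q ^ s := by
      rw [hq, Real.div_rpow hR.le hd.le, Real.rpow_neg hd.le, Real.rpow_neg hR.le]
      have := Real.rpow_pos_of_pos hR s
      have := Real.rpow_pos_of_pos hd s
      field_simp
    rw [this]
    have := Real.rpow_pos_of_pos hR (-s)
    gcongr
  have hRs := Real.rpow_pos_of_pos hR (-s)
  have hbr : 2 * (S * ((2 * r) ^ (1 - s) / (1 - s)) * I) + 4 * (S * (d ^ (-s) / s)) * V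
      ≤ X * (8 * S + 4 * 2 ^ n * S * ω / s₀) * q * (I + P) / (1 - s) := by
    have b1 : 2 * (S * ((2 * r) ^ (1 - s) / (1 - s)) * I) ≤ X * (8 * S) * q * I / (1 - s) := by
      calc 2 * (S * ((2 * r) ^ (1 - s) / (1 - s)) * I) ≤ 2 * (S * (4 * X / (1 - s)) * I) := by
            gcongr
        _ = X * (8 * S) * 1 * I / (1 - s) := by ring
        _ ≤ _ := by gcongr
    have b2 : 4 * (S * (d ^ (-s) / s)) * V ≤ X * (4 * 2 ^ n * S * ω / s₀) * q * P / (1 - s) := by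
      calc 4 * (S * (d ^ (-s) / s)) * V
          ≤ 4 * (S * (R ^ (-s) * q / s₀)) * (2 ^ n * (R * P) * ω) := by
            rw [hRn] at hV
            gcongr
        _ = (R ^ (-s) * R) * (4 * 2 ^ n * S * ω / s₀) * q * P * 1 := by ring
        _ ≤ (R ^ (-s) * R) * (4 * 2 ^ n * S * ω / s₀) * q * P * (1 / (1 - s)) := by gcongr
        _ = _ := by rw [hXR]; ring
    have b3 : X * (8 * S) * q * I / (1 - s) + X * (4 * 2 ^ n * S * ω / s₀) * q * P / (1 - s)
        ≤ X * (8 * S + 4 * 2 ^ n * S * ω / s₀) * q * (I + P) / (1 - s) := by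
      have c1 : 0 ≤ X * (8 * S) * q * P / (1 - s) := by positivity
      have c2 : 0 ≤ X * (4 * 2 ^ n * S * ω / s₀) * q * I / (1 - s) := by positivity
      calc _ ≤ X * (8 * S) * q * I / (1 - s) + X * (4 * 2 ^ n * S * ω / s₀) * q * P / (1 - s)
            + (X * (8 * S) * q * P / (1 - s) + X * (4 * 2 ^ n * S * ω / s₀) * q * I / (1 - s)) :=
            le_add_of_nonneg_right (by linarith)
        _ = _ := by ring
    linarith
  have hAV : (2 * M / d * V) ^ 2
      ≤ (2 ^ (n + 1) * M * ω) ^ 2 * (q ^ 3 / (1 - s)) * P * (I + P) := by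
    calc (2 * M / d * V) ^ 2 ≤ (2 * M / d * (2 ^ n * (R * P) * ω)) ^ 2 := by
          rw [hRn] at hV
          gcongr
      _ = (2 ^ (n + 1) * M * ω) ^ 2 * (q ^ 2 * 1) * P * P := by
          rw [hq, pow_succ (2 : ℝ) n]; field_simp
      _ ≤ (2 ^ (n + 1) * M * ω) ^ 2 * (q ^ 3 * (1 / (1 - s))) * P * (I + P) := by
          have : q ^ 2 ≤ q ^ 3 := pow_le_pow_right₀ hq1 (by norm_num)
          gcongr
          linarith
      _ = _ := by ring
  have hZ : 0 < (2 * σ) ^ ((n : ℝ) + s) := Real.rpow_pos_of_pos (by linarith) _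
  have hmain : J ^ 2 - (2 * M / d * V) ^ 2 ≤ 32 * c * Lam / lam * 4 ^ (n + 2) * M ^ 2
      * (8 * S + 4 * 2 ^ n * S * ω / s₀) * (q ^ 3 / (1 - s)) * P * (I + P) := by
    set Br := X * (8 * S + 4 * 2 ^ n * S * ω / s₀) * q * (I + P) / (1 - s) with hBr
    have hBr0 : 0 ≤ Br := by positivity
    have h' := h.trans (mul_le_mul_of_nonneg_left hbr (by positivity))
    calc J ^ 2 - (2 * M / d * V) ^ 2
        = (2 * σ) ^ ((n : ℝ) + s) / lam *
          (lam * (2 * σ) ^ (-((n : ℝ) + s)) * (J ^ 2 - (2 * M / d * V) ^ 2)) := by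
          rw [Real.rpow_neg (by positivity)]
          field_simp
      _ ≤ (2 * σ) ^ ((n : ℝ) + s) / lam * (32 * c * Lam * (2 * M / d) ^ 2 * Br) := by gcongr
      _ ≤ (4 ^ (n + 1) * Y) / lam * (32 * c * Lam * (2 * M / d) ^ 2 * Br) := by gcongr
      _ = 32 * c * Lam / lam * 4 ^ (n + 2) * M ^ 2 * (8 * S + 4 * 2 ^ n * S * ω / s₀)
          * ((Y * X) / d ^ 2 * q / (1 - s)) * (I + P) := by
          rw [hBr, pow_succ 4 (n + 1)]; ring
      _ = _ := by
          rw [hXY, hq]; field_simp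
  linarith

theorem le_half_add_of_sq_le {J a b : ℝ} (ha : 0 ≤ a) (hb : 0 ≤ b) (h : J ^ 2 ≤ a * b) :
    J ≤ (a + b) / 2 := by
  refine le_of_sq_le_sq ?_ (by positivity)
  nlinarith [sq_nonneg (a - b)]

end RealEstimates

/-! ### From directional derivatives to the gradient, and the conclusion. -/

theorem norm_le_sum_abs_single {n : ℕ} (T : Rn n →L[ℝ] ℝ) :
    ‖T‖ ≤ ∑ i, |T (EuclideanSpace.single i 1)| := by
  refine T.opNorm_le_bound (Finset.sum_nonneg fun i _ => abs_nonneg _) fun x => ?_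
  have hx : x = ∑ i, x i • EuclideanSpace.single i (1 : ℝ) := by
    simpa using ((EuclideanSpace.basisFun (Fin n) ℝ).sum_repr x).symm
  calc ‖T x‖ = ‖∑ i, x i * T (EuclideanSpace.single i 1)‖ := by
        conv_lhs => rw [hx]
        simp [map_sum]
    _ ≤ ∑ i, ‖x i * T (EuclideanSpace.single i 1)‖ := norm_sum_le _ _
    _ ≤ ∑ i, ‖x‖ * |T (EuclideanSpace.single i 1)| := by
        refine Finset.sum_le_sum fun i _ => ?_
        rw [norm_mul]
        exact mul_le_mul_of_nonneg_right (PiLp.norm_apply_le x i) (norm_nonneg _)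
    _ = _ := by rw [← Finset.mul_sum, mul_comm]

theorem volume_real_ball_le {n : ℕ} {σ R : ℝ} (hσ : 0 < σ) (hσR : σ ≤ 2 * R) :
    volume.real (Metric.ball (0 : Rn n) σ)
      ≤ 2 ^ n * R ^ n * volume.real (Metric.ball (0 : Rn n) 1) := by
  rw [measureReal_def, Measure.addHaar_ball_of_pos volume 0 hσ, ENNReal.toReal_mul,
    ENNReal.toReal_ofReal (by positivity), finrank_euclideanSpace, Fintype.card_fin, ← mul_pow,
    measureReal_def]
  gcongr

theorem mainTheorem4 (n : ℕ) (hn : 2 ≤ n) (lam Lam s₀ : ℝ)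
    (hlam : 0 < lam) (hLam : 0 < Lam) (hs₀ : 0 < s₀) :
    ∃ C : ℝ, 0 < C ∧
      ∀ (s : ℝ), s₀ < s → s < 1 →
      ∀ (W : ℝ → ℝ), ContDiff ℝ 3 W →
      ∀ (K : Rn n → ℝ), KernelClassL2 n s lam Lam K →
      ∀ (R : ℝ), 0 < R →
      ∀ (u : Rn n → ℝ), (∀ x, u x ∈ Set.Ioo (-1 : ℝ) 1) →
        IsStableSolution K W (Metric.ball (0 : Rn n) (2 * R)) u →
        IntegrableOn (fun x => ‖gradient u x‖) (Metric.ball (0 : Rn n) R) volume ∧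
        ∫ x in Metric.ball (0 : Rn n) R, ‖gradient u x‖ ≤ C / (1 - s) * R ^ (n - 1) := by
  obtain ⟨χ, c, hχ⟩ := exists_isTruncation n
  obtain ⟨M, hM0, hM⟩ := exists_smoothTransition_deriv_le
  set S := sphereArea n
  have hS : 0 ≤ S := sphereArea_nonneg n
  set ω := volume.real (Metric.ball (0 : Rn n) 1)
  have hω : 0 ≤ ω := measureReal_nonneg
  have hc : 0 ≤ c := zero_le_one.trans hχ.one_le
  set a := (2 ^ (n + 1) * M * ω) ^ 2
    + 32 * c * Lam / lam * 4 ^ (n + 2) * M ^ 2 * (8 * S + 4 * 2 ^ n * S * ω / s₀) with ha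
  have ha0 : 0 ≤ a := by positivity
  have hn0 : (0 : ℝ) < n := by exact_mod_cast (by omega : 0 < n)
  -- The factor `27` appears because the choice `d = R(y - x)/3` below gives `(R/d)³ = 27/(y - x)³`.
  set B := 27 * ((1 + (n : ℝ) ^ 2 * a) / 2) with hB
  have hB0 : 0 < B := by positivity
  refine ⟨32000 * B, by positivity, fun s hss hs W hW K hK R hR u hu hst => ?_⟩
  have hs0 : 0 < s := hs₀.trans hss
  have h1s : 0 < 1 - s := by linarith
  have hone : 1 ≤ 1 / (1 - s) := (one_le_div h1s).2 (by linarith)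
  have hu1 : ∀ x, |u x| ≤ 1 := fun x => abs_le.2 ⟨(hu x).1.le, (hu x).2.le⟩
  have hΩ : IsOpen (Metric.ball (0 : Rn n) (2 * R)) := Metric.isOpen_ball
  have hu1Ω : ContDiffOn ℝ 1 u (Metric.ball (0 : Rn n) (2 * R)) :=
    hst.contDiffOn.of_le (by norm_num)
  have hgrad : ∀ x, ‖gradient u x‖ = ‖fderiv ℝ u x‖ := fun x => by
    rw [gradient, LinearIsometryEquiv.norm_map]
  have hint : ∀ r < 2 * R, IntegrableOn (fun x => ‖fderiv ℝ u x‖) (Metric.ball (0 : Rn n) r) :=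
    fun r hr => integrableOn_norm_fderiv hΩ hu1Ω hr subset_rfl
  simp only [hgrad]
  refine ⟨hint R (by linarith), ?_⟩
  set P := R ^ (n - 1) with hP
  have hP0 : 0 < P := by positivity
  set I : ℝ → ℝ := fun r => ∫ x in Metric.ball (0 : Rn n) r, ‖fderiv ℝ u x‖ with hI
  have hI0 : ∀ r, 0 ≤ I r := fun r => integral_nonneg fun x => norm_nonneg _
  -- the estimate between two concentric balls
  have hstep : ∀ ρ d, R ≤ ρ → 0 < d → ρ + 3 * d ≤ 3 / 2 * R →
      I ρ ≤ 1 / 2 * I (ρ + 3 * d) + (1 + (n : ℝ) ^ 2 * a) / 2 * ((R / d) ^ 3 / (1 - s)) * P := by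
    intro ρ d hρ hd hρd
    have hρ0 : 0 < ρ := hR.trans_le hρ
    have hq1 : 1 ≤ R / d := (one_le_div hd).2 (by linarith)
    have hQ : 1 ≤ (R / d) ^ 3 / (1 - s) := by
      rw [← mul_one_div]
      exact one_le_mul_of_one_le_of_one_le (one_le_pow₀ hq1) hone
    have hJ : ∀ i : Fin n, ∫ x in Metric.ball (0 : Rn n) ρ,
        |dirDeriv (EuclideanSpace.single i 1) u x|
        ≤ ((I (ρ + 3 * d) + P) / n + n * a * ((R / d) ^ 3 / (1 - s)) * P) / 2 := by
      intro i
      have h := directional_estimate hn hs0 hs hlam hLam hK hW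
        (e := EuclideanSpace.single i (1 : ℝ)) (by simp) hst hu1 hχ hM hρ0 hd (by linarith)
      have h2 := quadratic_bound (by omega) hs₀ hss hs hR hd (by linarith) (by linarith)
        (by linarith) (by linarith) (by linarith) hlam hc hLam.le hM0.le hS hω measureReal_nonneg
        (volume_real_ball_le (by linarith) (by linarith)) (hI0 _) h
      have h3 := hI0 (ρ + 3 * d)
      -- The product is split with `1/n` on the factor containing `I`, so that summing over the `n`
      -- coordinate directions leaves the coefficient `½`.
      refine le_half_add_of_sq_le (by positivity) (by positivity) (h2.trans_eq ?_)
      rw [← ha, ← hP]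
      simp only [hI]
      field_simp
    have hJi : ∀ i : Fin n, IntegrableOn (fun x => |dirDeriv (EuclideanSpace.single i 1) u x|)
        (Metric.ball (0 : Rn n) ρ) := by
      intro i
      refine (hint ρ (by linarith)).mono'
        (measurable_fderiv_apply_const ℝ u _).abs.aestronglyMeasurable
        (Filter.Eventually.of_forall fun x => ?_)
      have := (fderiv ℝ u x).le_opNorm (EuclideanSpace.single i (1 : ℝ))
      simpa using this
    calc I ρ ≤ ∫ x in Metric.ball (0 : Rn n) ρ,
          ∑ i, |dirDeriv (EuclideanSpace.single i 1) u x| :=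
          integral_mono (hint ρ (by linarith)) (integrable_finsetSum _ fun i _ => hJi i)
            fun x => norm_le_sum_abs_single _
      _ = ∑ i, ∫ x in Metric.ball (0 : Rn n) ρ, |dirDeriv (EuclideanSpace.single i 1) u x| :=
          integral_finsetSum _ fun i _ => hJi i
      _ ≤ ∑ _i : Fin n, ((I (ρ + 3 * d) + P) / n + n * a * ((R / d) ^ 3 / (1 - s)) * P) / 2 :=
          Finset.sum_le_sum fun i _ => hJ i
      _ = 1 / 2 * I (ρ + 3 * d) + 1 / 2 * P * 1
          + (n : ℝ) ^ 2 * a / 2 * ((R / d) ^ 3 / (1 - s)) * P := by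
          rw [Finset.sum_const, Finset.card_univ, Fintype.card_fin, nsmul_eq_mul]
          field_simp
      _ ≤ 1 / 2 * I (ρ + 3 * d) + 1 / 2 * P * ((R / d) ^ 3 / (1 - s))
          + (n : ℝ) ^ 2 * a / 2 * ((R / d) ^ 3 / (1 - s)) * P := by gcongr
      _ = _ := by ring
  have hmono : ∀ ρ, ρ ≤ 3 / 2 * R → I ρ ≤ I (3 / 2 * R) := fun ρ hρ =>
    setIntegral_mono_set (hint _ (by linarith))
      (Filter.Eventually.of_forall fun x => norm_nonneg _)
      (Metric.ball_subset_ball hρ).eventuallyLE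
  have hiter := le_of_iterated_bound (g := fun x => I (R * x) / P) (F := I (3 / 2 * R) / P)
    (B := B / (1 - s)) (by positivity)
    (fun x _ hx => by
      have := hmono (R * x) (by nlinarith)
      gcongr)
    (fun x y hx hxy hy => by
      have hyx : 0 < y - x := by linarith
      have h := hstep (R * x) (R * (y - x) / 3) (by nlinarith) (by positivity) (by nlinarith)
      rw [show R * x + 3 * (R * (y - x) / 3) = R * y by ring] at h
      have hQ : (R / (R * (y - x) / 3)) ^ 3 = 27 / (y - x) ^ 3 := by
        field_simp; norm_num
      rw [hQ] at h
      rw [div_le_iff₀ hP0]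
      refine h.trans_eq ?_
      rw [hB]
      field_simp)
  simp only [mul_one] at hiter
  rw [div_le_iff₀ hP0] at hiter
  refine hiter.trans_eq ?_
  ring
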